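/- Let $p$ be a prime and let $G$ be a finite $p$-group of coclass $4$; that is, $|G|=p^n$ and the nilpotency class of $G$ is $n-4$. Let $Z(G)$ be the center of $G$, let $Z_2(G)$ be its second center (so $Z_2(G)/Z(G)=Z(G/Z(G))$), and let $G'$ be its derived subgroup. Write $d(H)$ for the minimal number of generators of a finite group $H$, and $C_m$ for the cyclic group of order $m$. Let $\mathrm{Aut}_z(G)$ be the group of central automorphisms of $G$, i.e. of those automorphisms $\alpha$ with $x^{-1}\alpha(x)\in Z(G)$ for all $x\in G$, and let $Z(\mathrm{Inn}(G))$ be the center of the group of inner automorphisms of $G$; both are subgroups of $\mathrm{Aut}(G)$. Then $\mathrm{Aut}_z(G)=Z(\mathrm{Inn}(G))$ if and only if one of the following holds: (a) $Z(G)\simeq C_p$ and $d(G)=d(Z_2(G)/Z(G))\in\{2,3,4\}$; (b) $Z(G)\simeq C_{p^2}$ and one of the following holds: (i) $Z_2(G)/Z(G)\simeq G/G'$; (ii) $Z_2(G)/Z(G)\simeq C_{p^2}\times C_p$ and $G/G'\simeq C_{p^3}\times C_p$; (iii) $Z_2(G)/Z(G)\simeq C_{p^2}\times C_p$ and $G/G'\simeq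 C_{p^4}\times C_p$; (c) $Z(G)\simeq C_{p^3}$ and $Z_2(G)/Z(G)\simeq G/G'$. -/

import Mathlib

/-- The group `Aut_z(G)` of central automorphisms of `G`: the automorphisms `α` such that
`x⁻¹ α(x)` lies in the center `Z(G)` for every `x`. -/
def centralAut (G : Type*) [Group G] : Subgroup (MulAut G) where
  carrier := {α | ∀ x : G, x⁻¹ * α x ∈ Subgroup.center G}
  one_mem' x := by simp
  mul_mem' {α β} hα hβ x := by
    have h := mul_mem (hβ x) (hα (β x))
    rwa [mul_assoc, mul_inv_cancel_left] at h
  inv_mem' {α} hα x := by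
    have h := inv_mem (hα (α⁻¹ x))
    rwa [MulAut.apply_inv_self, mul_inv_rev, inv_inv] at h

/-- The group `Inn(G)` of inner automorphisms of `G`. -/
def innerAut (G : Type*) [Group G] : Subgroup (MulAut G) :=
  (MulAut.conj : G →* MulAut G).range

/-- The center `Z(Inn(G))` of the inner automorphism group, as a subgroup of `Aut(G)`. -/
def centerInnerAut (G : Type*) [Group G] : Subgroup (MulAut G) :=
  (Subgroup.center (innerAut G)).map (innerAut G).subtype

/-- The second center `Z_2(G)`: the second term of the upper central series. -/
abbrev secondCenter (G : Type*) [Group G] : Subgroup G :=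
  Subgroup.upperCentralSeries G 2

/-- The quotient group `Z_2(G) / Z(G)`. -/
abbrev SecondCenterQuot (G : Type*) [Group G] : Type _ :=
  secondCenter G ⧸ (Subgroup.center G).subgroupOf (secondCenter G)

/-- `G` has order `p ^ n` and nilpotency class `n - k`, that is, `G` is a `p`-group
of coclass `k`. -/
def HasCoclass (p : ℕ) (G : Type*) [Group G] (k : ℕ) : Prop :=
  Group.IsNilpotent G ∧ ∃ n : ℕ,
    Nat.card G = p ^ n ∧ n = Group.nilpotencyClass G + k

/-- The cyclic group `C_m` of order `m` (for `m ≥ 1`), written multiplicatively. -/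
abbrev Cyc (m : ℕ) : Type := Multiplicative (ZMod m)

/-! ### Generator numbers and the Frattini subgroup of finite `p`-groups. -/

section Rank

open Subgroup
open scoped commutatorElement

/-! Write `Z = Z(G)`, `B = Z₂(G)/Z(G)`, `A = G/G'`. A central automorphism is `x ↦ x f(x)` with `f :
G → Z` a homomorphism such that `f(z) = z⁻¹` only for `z = 1`; those in `Z(Inn G)` come from the
maps `x ↦ [g, x]` with `g ∈ Z₂(G)`. So the question is which `f` lie in the image of the commutator
pairing `Z₂(G) → Hom(G, Z)`, an image isomorphic to `B`.

If `Z` is cyclic and `G` nonabelian, the unique subgroup of order `p` in `Z` lies in `G'`, so every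
`f` is admissible (`IsPGroup.eq_one_of_map_eq_inv`). By duality `Hom(G, Z) ≃ A / A^|Z|`, so equality
of the two groups amounts to `|B| = |A / A^|Z||`, and it then yields an isomorphism `B ≃ A / A^|Z|`.

With `|Z| = p^k` and `|B| = p^b`, coclass `4` gives `|A| ≤ p^5` and either `k + b ≤ 5`, or class two
with `k + b = 6` (`HasCoclass.orders`). A noncyclic center would force `2 d(G) ≤ b`, hence class two
with `k = 2`, `b = 4`, `d(G) = 2`, while `G/Z` would be elementary abelian of rank `4`. For a cyclic
center, `k = 1` gives `b = d(G)`, and `b = 5` fails because `|G : Z|` is a square in class two. For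
`k = 2` and `b ≤ 3`, either `A^(p^2) = 1` or `A ≃ C_{p^m} × C_p` with `m = 3, 4`. For `k = 3` and `b
≤ 2`, `A^(p^3) = 1`. In class two `G' = Z` and `A ≃ B`, which also gives `k ≤ b` and excludes `k ≥
4`. -/

lemma Group.rank_eq_of_ker_le_frattini {G H : Type*} [Group G] [Group H] [Finite G] [Finite H]
    (f : G →* H) (hf : Function.Surjective f) (hk : f.ker ≤ frattini G) :
    Group.rank G = Group.rank H := by
  classical
  refine le_antisymm ?_ (Group.rank_le_of_surjective f hf)
  obtain ⟨S, hS, hcl⟩ := Group.rank_spec H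
  set T : Finset G := S.image (Function.surjInv hf)
  have hfT : f '' (T : Set G) = S := by
    simp only [T, Finset.coe_image, Set.image_image, Function.surjInv_eq, Set.image_id']
  have hT : closure (T : Set G) = ⊤ := by
    apply frattini_nongenerating
    have h1 : closure (T : Set G) ⊔ f.ker = ⊤ := by
      rw [← comap_map_eq, MonoidHom.map_closure, hfT, hcl, comap_top]
    exact top_le_iff.mp (h1 ▸ sup_le_sup_left hk _)
  exact (Group.rank_le hT).trans (Finset.card_image_le.trans hS.le)

/-- Normalizers grow in a nilpotent group, so a maximal subgroup is normal. Cauchy's theorem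
supplies `y`, and the preimage of `zpowers y` strictly contains `M`. -/
lemma IsPGroup.coatom_normal_and_zpowers {p : ℕ} [Fact p.Prime] {G : Type*} [Group G] [Finite G]
    (hG : IsPGroup p G) {M : Subgroup G} (hM : IsCoatom M) :
    ∃ _ : M.Normal, ∃ y : G ⧸ M, orderOf y = p ∧ ∀ z, z ∈ zpowers y := by
  have := hG.isNilpotent
  have hN : M.Normal := NormalizerCondition.normal_of_coatom M Group.normalizerCondition_of_isNilpotent hM
  refine ⟨hN, ?_⟩
  have hQ : IsPGroup p (G ⧸ M) := hG.to_quotient M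
  have hnt : Nontrivial (G ⧸ M) := QuotientGroup.nontrivial_iff.mpr hM.1
  obtain ⟨n, hn, hc⟩ := hQ.nontrivial_iff_card.mp hnt
  obtain ⟨y, hy⟩ := exists_prime_orderOf_dvd_card' (G := G ⧸ M) p
    (hc ▸ dvd_pow_self p hn.ne')
  refine ⟨y, hy, ?_⟩
  have hlt : M < (zpowers y).comap (QuotientGroup.mk' M) := by
    obtain ⟨g, rfl⟩ := QuotientGroup.mk'_surjective M y
    refine lt_of_le_of_ne (fun m hm => ?_) (fun h => ?_)
    · have : QuotientGroup.mk' M m = 1 := (QuotientGroup.eq_one_iff m).mpr hm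
      rw [mem_comap, this]; exact one_mem _
    · have hg : g ∈ M := by rw [h]; exact mem_zpowers _
      have : QuotientGroup.mk' M g = 1 := (QuotientGroup.eq_one_iff g).mpr hg
      rw [this, orderOf_one] at hy
      exact (Fact.out : p.Prime).one_lt.ne hy
  have htop := hM.2 _ hlt
  intro z
  obtain ⟨g, rfl⟩ := QuotientGroup.mk'_surjective M z
  have : g ∈ (zpowers y).comap (QuotientGroup.mk' M) := htop ▸ mem_top g
  exact this

lemma IsPGroup.pow_mem_frattini {p : ℕ} [Fact p.Prime] {G : Type*} [Group G] [Finite G]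
    (hG : IsPGroup p G) (g : G) : g ^ p ∈ frattini G := by
  rw [frattini, Order.radical]
  simp only [mem_iInf]
  intro M hM
  obtain ⟨hN, y, hy, hz⟩ := hG.coatom_normal_and_zpowers hM
  rw [← QuotientGroup.eq_one_iff, QuotientGroup.mk_pow]
  obtain ⟨k, hk⟩ := hz (g : G ⧸ M)
  simp only at hk
  rw [← hk, ← zpow_natCast, zpow_comm, zpow_natCast, ← hy, pow_orderOf_eq_one, one_zpow]

lemma IsPGroup.commutator_le_frattini {p : ℕ} [Fact p.Prime] {G : Type*} [Group G] [Finite G]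
    (hG : IsPGroup p G) : commutator G ≤ frattini G := by
  rw [frattini, Order.radical]
  simp only [le_iInf_iff]
  intro M hM
  obtain ⟨hN, y, hy, hz⟩ := hG.coatom_normal_and_zpowers hM
  rw [commutator_def, commutator_le]
  intro a _ b _
  rw [← QuotientGroup.eq_one_iff]
  change QuotientGroup.mk' M ⁅a, b⁆ = 1
  obtain ⟨k, hk⟩ := hz (a : G ⧸ M)
  obtain ⟨l, hl⟩ := hz (b : G ⧸ M)
  simp only at hk hl
  have : (QuotientGroup.mk' M ⁅a, b⁆) = ⁅(a : G ⧸ M), (b : G ⧸ M)⁆ :=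
    map_commutatorElement (QuotientGroup.mk' M) a b
  rw [this, commutatorElement_eq_one_iff_mul_comm, ← hk, ← hl, ← zpow_add, ← zpow_add, add_comm]

/-- A finite abelian group of prime exponent `p` and rank `r` has order `p ^ r`. -/
lemma Group.card_eq_pow_rank_of_elementary {p : ℕ} [Fact p.Prime] {E : Type*} [CommGroup E]
    [Finite E] (hE : ∀ x : E, x ^ p = 1) : Nat.card E = p ^ Group.rank E := by
  classical
  have _ : Module (ZMod p) (Additive E) :=
    AddCommGroup.zmodModule (fun x => congrArg Additive.ofMul (hE x.toMul))
  have := Fintype.ofFinite (Additive E)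
  have hcard : Nat.card E = p ^ Module.finrank (ZMod p) (Additive E) := by
    have h := Module.card_eq_pow_finrank (K := ZMod p) (V := Additive E)
    rw [ZMod.card, ← Nat.card_eq_fintype_card] at h
    exact h
  have hp := (Fact.out : p.Prime)
  have : Module.Finite (ZMod p) (Additive E) := Module.Finite.of_finite
  let b := Module.finBasis (ZMod p) (Additive E)
  let S : Finset E := Finset.univ.image (fun i => (b i).toMul)
  have hS : closure (S : Set E) = ⊤ := by
    have h1 : AddSubgroup.closure (Set.range b) = ⊤ := by
      have h2 : Submodule.span (ZMod p) (Set.range b) ≤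
          AddSubgroup.toZModSubmodule p (AddSubgroup.closure (Set.range b)) :=
        Submodule.span_le.mpr AddSubgroup.subset_closure
      rw [b.span_eq] at h2
      exact top_le_iff.mp fun x _ => h2 (Submodule.mem_top (x := x))
    rw [eq_top_iff]
    intro x _
    have hx : Additive.ofMul x ∈ AddSubgroup.closure (Set.range b) := h1 ▸ AddSubgroup.mem_top _
    have hle : AddSubgroup.closure (Set.range b) ≤ Subgroup.toAddSubgroup (closure (S : Set E)) := by
      rw [AddSubgroup.closure_le]
      rintro _ ⟨i, rfl⟩
      exact Subgroup.subset_closure (k := (S : Set E))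
        (Finset.mem_coe.mpr (Finset.mem_image_of_mem _ (Finset.mem_univ i)))
    exact hle hx
  have hle : Group.rank E ≤ Module.finrank (ZMod p) (Additive E) :=
    (Group.rank_le hS).trans (Finset.card_image_le.trans (by simp))
  refine le_antisymm (Nat.le_of_dvd (pow_pos hp.pos _) ?_) ?_
  · exact card_dvd_exponent_pow_rank' E hE
  · rw [hcard]; exact Nat.pow_le_pow_right hp.pos hle

lemma Group.isCyclic_of_rank_le_one {G : Type*} [Group G] [Finite G] (h : Group.rank G ≤ 1) :
    IsCyclic G := by
  obtain ⟨S, hS, hcl⟩ := Group.rank_spec G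
  rw [← hS] at h
  obtain ⟨x, hx⟩ := Finset.card_le_one_iff_subset_singleton.mp h
  refine ⟨x, fun y => ?_⟩
  have : y ∈ closure (S : Set G) := hcl ▸ mem_top y
  change y ∈ zpowers x
  rw [zpowers_eq_closure]
  exact closure_mono (by exact_mod_cast hx) this

end Rank

/-! ### Homomorphisms into finite cyclic groups. -/

section Duality

open Subgroup

/-- For a finite cyclic group `Z`, the group of homomorphisms from a finite abelian group `A`
to `Z` is isomorphic to `A / A ^ |Z|`. -/
lemma CommGroup.nonempty_monoidHom_mulEquiv_quotient_pow (A Z : Type*) [CommGroup A] [Finite A]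
    [CommGroup Z] [Finite Z] [IsCyclic Z] :
    Nonempty ((A →* Z) ≃* A ⧸ (powMonoidHom (Nat.card Z) : A →* A).range) := by
  set m := Nat.card Z
  set Q := A ⧸ (powMonoidHom m : A →* A).range
  have hm : NeZero m := ⟨Nat.card_pos.ne'⟩
  -- Realizing `Z` as the `m`-th roots of unity turns homomorphisms `A → Z` into complex characters
  -- of `A / A^m`, and a finite abelian group is isomorphic to its character group.
  let e : Z ≃* rootsOfUnity m ℂ := mulEquivOfCyclicCardEq (Complex.card_rootsOfUnity m).symm
  let ι : Z →* ℂˣ := (rootsOfUnity m ℂ).subtype.comp e.toMonoidHom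
  have hι : Function.Injective ι := Subtype.val_injective.comp e.injective
  have : NeZero (Monoid.exponent Q) := ⟨Monoid.exponent_ne_zero_of_finite⟩
  obtain ⟨d⟩ := CommGroup.monoidHom_mulEquiv_of_hasEnoughRootsOfUnity Q ℂ
  have key (f : A →* Z) : ∀ x ∈ (powMonoidHom m : A →* A).range, ι.comp f x = 1 := by
    rintro _ ⟨a, rfl⟩
    simp [m]
  let Φ : (A →* Z) →* (Q →* ℂˣ) :=
    { toFun := fun f => QuotientGroup.lift _ (ι.comp f) (key f)
      map_one' := by
        ext x
        simp
      map_mul' := fun f g => by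
        apply QuotientGroup.monoidHom_ext
        ext x
        change ((ι (f x * g x) : ℂˣ) : ℂ) = _
        rw [map_mul]
        rfl }
  have hΦ : Function.Bijective Φ := by
    constructor
    · intro f g h
      ext x
      apply hι
      exact DFunLike.congr_fun h (x : Q)
    · intro φ
      have hr (a : A) : φ (a : Q) ∈ rootsOfUnity m ℂ := by
        rw [mem_rootsOfUnity, ← map_pow, ← QuotientGroup.mk_pow,
          (QuotientGroup.eq_one_iff (N := (powMonoidHom m : A →* A).range) (a ^ m)).mpr
            ⟨a, rfl⟩, map_one]
      refine ⟨e.symm.toMonoidHom.comp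
        ((φ.comp (QuotientGroup.mk' _)).codRestrict (rootsOfUnity m ℂ) hr), ?_⟩
      apply QuotientGroup.monoidHom_ext
      ext x
      simp [Φ, ι]
      rfl
  exact ⟨(MulEquiv.ofBijective Φ hΦ).trans d⟩

/-- Homomorphisms to an abelian group factor through the abelianization. -/
def Abelianization.liftMulEquiv (G Z : Type*) [Group G] [CommGroup Z] :
    (G →* Z) ≃* (Abelianization G →* Z) :=
  { Abelianization.lift with
    map_mul' := fun f g => by
      ext x
      simp }

lemma nonempty_monoidHom_mulEquiv_abelianization_quotient (G Z : Type*) [Group G] [Finite G]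
    [CommGroup Z] [Finite Z] [IsCyclic Z] :
    Nonempty ((G →* Z) ≃*
      Abelianization G ⧸ (powMonoidHom (Nat.card Z) : Abelianization G →* Abelianization G).range) := by
  obtain ⟨e⟩ := CommGroup.nonempty_monoidHom_mulEquiv_quotient_pow (Abelianization G) Z
  exact ⟨(Abelianization.liftMulEquiv G Z).trans e⟩

lemma card_monoidHom_eq_index (G Z : Type*) [Group G] [Finite G]
    [CommGroup Z] [Finite Z] [IsCyclic Z] :
    Nat.card (G →* Z) =
      (powMonoidHom (Nat.card Z) : Abelianization G →* Abelianization G).range.index :=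
  Nat.card_congr (nonempty_monoidHom_mulEquiv_abelianization_quotient G Z).some.toEquiv

lemma card_monoidHom_le_card (G Z : Type*) [Group G] [Finite G]
    [CommGroup Z] [Finite Z] [IsCyclic Z] : Nat.card (G →* Z) ≤ Nat.card G := by
  rw [card_monoidHom_eq_index]
  refine (Nat.card_le_card_of_surjective _ (QuotientGroup.mk'_surjective _)).trans ?_
  exact Nat.card_le_card_of_surjective _ (QuotientGroup.mk'_surjective (commutator G))

/-- In a bilinear pairing with values in a finite cyclic group, the left kernel has index at most
the index of any normal subgroup of the right kernel. -/
lemma index_ker_le_of_pairing {X Y Z : Type*} [Group X] [Group Y] [Finite Y] [CommGroup Z]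
    [Finite Z] [IsCyclic Z] (β : X →* (Y →* Z)) (K : Subgroup Y) [K.Normal]
    (hK : ∀ x, ∀ y ∈ K, β x y = 1) : β.ker.index ≤ K.index := by
  rw [Subgroup.index_ker]
  have : Finite (Y ⧸ K →* Z) := DFunLike.finite _
  refine le_trans (Nat.card_le_card_of_injective
    (fun f : β.range => QuotientGroup.lift K f.1 ?_) ?_) (card_monoidHom_le_card (Y ⧸ K) Z)
  · obtain ⟨_, x, rfl⟩ := f
    exact hK x
  · intro f g h
    ext y
    exact DFunLike.congr_fun h (y : Y ⧸ K)

end Duality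

/-! ### Power subgroups of finite abelian `p`-groups. -/

section AbelianPGroup

open Subgroup

variable {p : ℕ} [Fact p.Prime]

lemma IsPGroup.exists_orderOf_eq_pow_succ {A : Type*} [Group A] (hA : IsPGroup p A) {j : ℕ}
    {x : A} (hx : x ^ p ^ j ≠ 1) : ∃ y : A, orderOf y = p ^ (j + 1) := by
  have hp := (Fact.out : p.Prime)
  obtain ⟨e, he⟩ := (IsPGroup.iff_orderOf.mp hA) x
  have hje : j < e := by
    by_contra! h
    exact hx (orderOf_dvd_iff_pow_eq_one.mp (he ▸ pow_dvd_pow p h))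
  refine ⟨x ^ p ^ (e - (j + 1)), ?_⟩
  rw [orderOf_pow_of_dvd (pow_pos hp.pos _).ne' (he ▸ pow_dvd_pow p (Nat.sub_le _ _)), he,
    Nat.pow_div (Nat.sub_le _ _) hp.pos]
  congr 1
  omega

lemma range_powMonoidHom_eq_bot {A : Type*} [CommGroup A] {q : ℕ} (h : ∀ x : A, x ^ q = 1) :
    (powMonoidHom q : A →* A).range = ⊥ := by
  rw [eq_bot_iff]
  rintro _ ⟨x, rfl⟩
  exact mem_bot.mpr (h x)

lemma index_range_powMonoidHom_of_forall_pow {A : Type*} [CommGroup A] {q : ℕ}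
    (h : ∀ x : A, x ^ q = 1) : (powMonoidHom q : A →* A).range.index = Nat.card A := by
  rw [range_powMonoidHom_eq_bot h, index_bot]

lemma nonempty_mulEquiv_quotient_pow {A : Type*} [CommGroup A] {q : ℕ}
    (h : ∀ x : A, x ^ q = 1) : Nonempty (A ⧸ (powMonoidHom q : A →* A).range ≃* A) :=
  ⟨(QuotientGroup.quotientMulEquivOfEq (range_powMonoidHom_eq_bot h)).trans
    QuotientGroup.quotientBot⟩

/-- If `A / A ^ (p ^ k)` has order less than `p ^ k`, then `A` has exponent dividing `p ^ k`. -/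
lemma IsPGroup.pow_eq_one_of_index_lt {A : Type*} [CommGroup A] [Finite A] (hA : IsPGroup p A)
    {k : ℕ} (h : (powMonoidHom (p ^ k) : A →* A).range.index < p ^ k) (x : A) :
    x ^ p ^ k = 1 := by
  have hp := (Fact.out : p.Prime)
  rw [index_range] at h
  by_contra hx
  -- The index of `A^(p^k)` is the order of the `p^k`-torsion, which would contain the subgroup of
  -- order `p^k` generated by `y^p`.
  obtain ⟨y, hy⟩ := hA.exists_orderOf_eq_pow_succ hx
  have hyp : orderOf (y ^ p) = p ^ k := by
    rw [orderOf_pow_of_dvd hp.ne_zero (hy ▸ dvd_pow_self p k.succ_ne_zero), hy, pow_succ,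
      Nat.mul_div_cancel _ hp.pos]
  have hle : zpowers (y ^ p) ≤ (powMonoidHom (p ^ k) : A →* A).ker := by
    rw [zpowers_le, MonoidHom.mem_ker, powMonoidHom_apply, ← hyp, pow_orderOf_eq_one]
  have := card_le_of_le hle
  rw [Nat.card_zpowers, hyp] at this
  omega

/-- If `A / A ^ (p ^ (j + 1))` has exponent dividing `p ^ j`, then so does `A`. -/
lemma IsPGroup.pow_eq_one_of_forall_mem_range {A : Type*} [CommGroup A] [Finite A]
    (hA : IsPGroup p A) {j : ℕ}
    (h : ∀ x : A, x ^ p ^ j ∈ (powMonoidHom (p ^ (j + 1)) : A →* A).range) (x : A) :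
    x ^ p ^ j = 1 := by
  have hp := (Fact.out : p.Prime)
  by_contra hx
  obtain ⟨y, hy⟩ := hA.exists_orderOf_eq_pow_succ hx
  -- Comparing indices shows that the `p^(j+1)`-torsion is no larger than the `p^j`-torsion; an
  -- element of order `p^(j+1)` contradicts this.
  have hR : (powMonoidHom (p ^ j) : A →* A).range ≤ (powMonoidHom (p ^ (j + 1)) : A →* A).range := by
    rintro _ ⟨z, rfl⟩
    exact h z
  have hcard := index_antitone hR
  rw [index_range, index_range] at hcard
  have hK : (powMonoidHom (p ^ j) : A →* A).ker ≤ (powMonoidHom (p ^ (j + 1)) : A →* A).ker := by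
    intro z hz
    rw [MonoidHom.mem_ker, powMonoidHom_apply] at hz ⊢
    rw [pow_succ, pow_mul, hz, one_pow]
  have hyK : y ∈ (powMonoidHom (p ^ (j + 1)) : A →* A).ker := by
    rw [MonoidHom.mem_ker, powMonoidHom_apply, ← hy, pow_orderOf_eq_one]
  rw [← eq_of_le_of_card_ge hK hcard, MonoidHom.mem_ker, powMonoidHom_apply,
    ← orderOf_dvd_iff_pow_eq_one, hy, Nat.pow_dvd_pow_iff_le_right hp.one_lt] at hyK
  omega

/-- Since `|A / A^q|` is the order of the `q`-torsion, this computes the index of a power subgroup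
from a cyclic decomposition. -/
lemma card_ker_powMonoidHom_pi {ι : Type*} [Fintype ι] (n : ι → ℕ) (hn : ∀ i, n i ≠ 0) (q : ℕ) :
    Nat.card (powMonoidHom q : (∀ i, Multiplicative (ZMod (n i))) →* _).ker =
      ∏ i, (n i).gcd q := by
  have (i : ι) : NeZero (n i) := ⟨hn i⟩
  have e : (powMonoidHom q : (∀ i, Multiplicative (ZMod (n i))) →* _).ker ≃
      ∀ i, (powMonoidHom q : Multiplicative (ZMod (n i)) →* _).ker :=
    { toFun := fun x i => ⟨x.1 i, congrFun x.2 i⟩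
      invFun := fun x => ⟨fun i => (x i).1, funext fun i => (x i).2⟩
      left_inv := fun x => rfl
      right_inv := fun x => rfl }
  rw [Nat.card_congr e, Nat.card_pi]
  refine Finset.prod_congr rfl fun i _ => ?_
  rw [IsCyclic.card_powMonoidHom_ker, Nat.card_congr Multiplicative.toAdd, Nat.card_zmod]

lemma MulEquiv.card_ker_powMonoidHom {A B : Type*} [CommGroup A] [CommGroup B] (e : A ≃* B)
    (q : ℕ) : Nat.card (powMonoidHom q : A →* A).ker = Nat.card (powMonoidHom q : B →* B).ker := by
  refine Nat.card_congr (e.toEquiv.subtypeEquiv fun a => ?_)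
  change a ^ q = 1 ↔ (e a) ^ q = 1
  rw [← map_pow, map_eq_one_iff e e.injective]

lemma card_cyc (m : ℕ) : Nat.card (Cyc m) = m := by
  rw [Nat.card_congr Multiplicative.toAdd, Nat.card_zmod]

lemma cyc_pow_eq_one (m : ℕ) (x : Cyc m) : x ^ m = 1 :=
  orderOf_dvd_iff_pow_eq_one.mp ((_root_.orderOf_dvd_natCard x).trans (card_cyc m).dvd)

lemma cyc_pow_eq_one_of_dvd {m q : ℕ} (h : m ∣ q) (x : Cyc m) : x ^ q = 1 :=
  orderOf_dvd_iff_pow_eq_one.mp ((orderOf_dvd_iff_pow_eq_one.mpr (cyc_pow_eq_one m x)).trans h)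

/-- A noncyclic abelian `p`-group `A` with `|A / A ^ (p ^ 2)| ≤ p ^ 3` either has exponent
dividing `p ^ 2` or is isomorphic to `C_{p ^ m} × C_p` for some `m ≥ 3`. -/
lemma IsPGroup.exponent_or_mulEquiv_of_index_le {A : Type*} [CommGroup A] [Finite A]
    (hA : IsPGroup p A) (h1 : p ^ 2 ≤ (powMonoidHom p : A →* A).range.index)
    (h2 : (powMonoidHom (p ^ 2) : A →* A).range.index ≤ p ^ 3) :
    (∀ x : A, x ^ p ^ 2 = 1) ∨ ∃ m, 3 ≤ m ∧ Nonempty (A ≃* Cyc (p ^ m) × Cyc p) := by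
  classical
  have hp := (Fact.out : p.Prime)
  obtain ⟨ι, _, n, hn, ⟨e⟩⟩ := CommGroup.equiv_prod_multiplicative_zmod_of_finite A
  have hn0 (i : ι) : n i ≠ 0 := by have := hn i; omega
  rw [index_range, e.card_ker_powMonoidHom, card_ker_powMonoidHom_pi n hn0] at h1 h2
  have hP : IsPGroup p (∀ i, Multiplicative (ZMod (n i))) := hA.of_equiv e
  have hpow (i : ι) : ∃ a, 0 < a ∧ n i = p ^ a := by
    have hi : IsPGroup p (Multiplicative (ZMod (n i))) :=
      hP.of_surjective (Pi.evalMonoidHom _ i) (Function.surjective_eval i)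
    have : NeZero (n i) := ⟨hn0 i⟩
    obtain ⟨a, ha⟩ := IsPGroup.iff_card.mp hi
    rw [card_cyc] at ha
    refine ⟨a, Nat.pos_of_ne_zero ?_, ha⟩
    rintro rfl
    have := hn i
    rw [ha, pow_zero] at this
    exact lt_irrefl _ this
  choose a ha hna using hpow
  have hg (i : ι) (j : ℕ) : (n i).gcd (p ^ j) = p ^ min (a i) j := by
    rw [hna]
    rcases le_total (a i) j with h | h
    · rw [min_eq_left h, Nat.gcd_eq_left (pow_dvd_pow p h)]
    · rw [min_eq_right h, Nat.gcd_eq_right (pow_dvd_pow p h)]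
  have hsum (j : ℕ) : ∏ i, (n i).gcd (p ^ j) = p ^ ∑ i, min (a i) j := by
    simp_rw [hg, Finset.prod_pow_eq_pow_sum]
  rw [← pow_one p, hsum, pow_one, Nat.pow_le_pow_iff_right hp.one_lt] at h1
  rw [hsum, Nat.pow_le_pow_iff_right hp.one_lt] at h2
  by_cases hall : ∀ i, a i ≤ 2
  · left
    intro x
    apply e.injective
    rw [map_pow, map_one]
    funext i
    exact cyc_pow_eq_one_of_dvd (hna i ▸ pow_dvd_pow p (hall i)) (e x i)
  right
  push Not at hall
  obtain ⟨i₀, hi₀⟩ := hall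
  -- The hypotheses now say that there are at least two factors and that `∑ min (a i) 2 ≤ 3`. A
  -- factor with `a i₀ ≥ 3` uses up `2`, leaving room for exactly one more, of exponent `1`.
  have hone (i : ι) : min (a i) 1 = 1 := min_eq_right (ha i)
  simp only [hone, Finset.sum_const, smul_eq_mul, mul_one, Finset.card_univ] at h1
  rw [← Finset.add_sum_erase _ _ (Finset.mem_univ i₀), min_eq_right hi₀.le] at h2
  have hcard : 1 ≤ (Finset.univ.erase i₀).card := by
    rw [Finset.card_erase_of_mem (Finset.mem_univ _), Finset.card_univ]
    omega
  have hle : (Finset.univ.erase i₀).card ≤ ∑ i ∈ Finset.univ.erase i₀, min (a i) 2 := by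
    rw [Finset.card_eq_sum_ones]
    refine Finset.sum_le_sum fun i _ => le_min (ha i) (by norm_num)
  obtain ⟨j₀, hj₀⟩ := Finset.card_eq_one.mp (le_antisymm (by omega) hcard)
  rw [hj₀, Finset.sum_singleton] at h2
  have haj : a j₀ = 1 := by
    have := ha j₀
    rcases le_total (a j₀) 2 with h | h
    · rw [min_eq_left h] at h2; omega
    · rw [min_eq_right h] at h2; omega
  have hji : j₀ ≠ i₀ := Finset.ne_of_mem_erase (hj₀ ▸ Finset.mem_singleton_self j₀)
  have hcover (i : ι) : i = i₀ ∨ i = j₀ := by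
    by_cases hi : i = i₀
    · exact Or.inl hi
    · right
      have : i ∈ Finset.univ.erase i₀ := Finset.mem_erase.mpr ⟨hi, Finset.mem_univ _⟩
      rwa [hj₀, Finset.mem_singleton] at this
  let f : (∀ i, Multiplicative (ZMod (n i))) →* Cyc (n i₀) × Cyc (n j₀) :=
    (Pi.evalMonoidHom _ i₀).prod (Pi.evalMonoidHom _ j₀)
  have hf : Function.Bijective f := by
    constructor
    · intro x y hxy
      funext i
      rcases hcover i with rfl | rfl
      · exact congrArg Prod.fst hxy
      · exact congrArg Prod.snd hxy
    · rintro ⟨u, v⟩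
      let w : ∀ i, Multiplicative (ZMod (n i)) := Function.update (Function.update 1 j₀ v) i₀ u
      refine ⟨w, Prod.ext ?_ ?_⟩
      · change w i₀ = u
        simp only [w]
        rw [Function.update_self]
      · change w j₀ = v
        simp only [w]
        rw [Function.update_of_ne hji, Function.update_self]
  refine ⟨a i₀, hi₀, ?_⟩
  have hj1 : n j₀ = p := by rw [hna, haj, pow_one]
  have e₁ : Cyc (n i₀) ≃* Cyc (p ^ a i₀) := mulEquivOfCyclicCardEq (by rw [hna])
  have e₂ : Cyc (n j₀) ≃* Cyc p := mulEquivOfCyclicCardEq (by rw [card_cyc, card_cyc, hj1])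
  exact ⟨(e.trans (MulEquiv.ofBijective f hf)).trans (e₁.prodCongr e₂)⟩

lemma index_range_powMonoidHom_cyc_prod_le (m : ℕ) :
    (powMonoidHom (p ^ 2) : Cyc (p ^ m) × Cyc p →* _).range.index ≤ p ^ 3 := by
  have hp := (Fact.out : p.Prime)
  have : NeZero p := ⟨hp.ne_zero⟩
  have h1 : Nat.card (powMonoidHom (p ^ 2) : Cyc (p ^ m) →* _).ker ≤ p ^ 2 := by
    rw [IsCyclic.card_powMonoidHom_ker]
    exact Nat.gcd_le_right _ (pow_pos hp.pos _)
  rw [index_range]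
  calc _ ≤ Nat.card ((powMonoidHom (p ^ 2) : Cyc (p ^ m) →* _).ker × Cyc p) :=
        Nat.card_le_card_of_injective
          (fun x => (⟨x.1.1, congrArg Prod.fst x.2⟩, x.1.2)) (by
            rintro ⟨⟨x, y⟩, hx⟩ ⟨⟨x', y'⟩, hx'⟩ h
            simpa [Subtype.ext_iff] using h)
    _ ≤ p ^ 3 := by
        rw [Nat.card_prod, card_cyc, pow_succ]
        exact Nat.mul_le_mul_right _ h1

/-- Reduction modulo `p^2` in the first factor kills `A^(p^2)`; the induced surjection is bijective
because `A / A^(p^2)` has order at most `p^3`. -/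
lemma nonempty_mulEquiv_cyc_prod_of_quotient_pow {A : Type*} [CommGroup A] [Finite A] {m : ℕ}
    (hm : 2 ≤ m) (e : A ≃* Cyc (p ^ m) × Cyc p) :
    Nonempty (A ⧸ (powMonoidHom (p ^ 2) : A →* A).range ≃* Cyc (p ^ 2) × Cyc p) := by
  have hp := (Fact.out : p.Prime)
  have : NeZero p := ⟨hp.ne_zero⟩
  let g : Cyc (p ^ m) →* Cyc (p ^ 2) :=
    AddMonoidHom.toMultiplicative (ZMod.castHom (pow_dvd_pow p hm) (ZMod (p ^ 2))).toAddMonoidHom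
  have hg : Function.Surjective g := ZMod.castHom_surjective (pow_dvd_pow p hm)
  let f : A →* Cyc (p ^ 2) × Cyc p := (g.prodMap (MonoidHom.id _)).comp e.toMonoidHom
  have hf : Function.Surjective f :=
    (hg.prodMap Function.surjective_id).comp e.surjective
  have hcard : Nat.card (Cyc (p ^ 2) × Cyc p) = p ^ 3 := by
    rw [Nat.card_prod, card_cyc, card_cyc]; ring
  have hexp (z : Cyc (p ^ 2) × Cyc p) : z ^ p ^ 2 = 1 :=
    Prod.ext (cyc_pow_eq_one _ z.1) (cyc_pow_eq_one_of_dvd (dvd_pow_self p two_ne_zero) z.2)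
  have hle : (powMonoidHom (p ^ 2) : A →* A).range ≤ f.ker := by
    rintro _ ⟨x, rfl⟩
    rw [MonoidHom.mem_ker, powMonoidHom_apply, map_pow, hexp]
  have hidx : (powMonoidHom (p ^ 2) : A →* A).range.index ≤ p ^ 3 := by
    rw [index_range, e.card_ker_powMonoidHom, ← index_range]
    exact index_range_powMonoidHom_cyc_prod_le m
  refine ⟨MulEquiv.ofBijective (QuotientGroup.lift _ f hle) ?_⟩
  refine (Nat.bijective_iff_surjective_and_card _).mpr ⟨?_, ?_⟩
  · exact QuotientGroup.lift_surjective_of_surjective _ f hf hle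
  · refine le_antisymm (hcard ▸ hidx) ?_
    exact Nat.card_le_card_of_surjective _
      (QuotientGroup.lift_surjective_of_surjective _ f hf hle)

end AbelianPGroup

/-! ### Orders of central and derived subgroups against the class. -/

section NilpotentOrders

open Subgroup

variable {p : ℕ} [Fact p.Prime]

/-- Under conjugation the number of fixed points in `N` is divisible by `p`, and `1` is one of them,
so `N` has another central element. -/
lemma IsPGroup.exists_mem_center_of_normal {G : Type*} [Group G] [Finite G] (hG : IsPGroup p G)
    {N : Subgroup G} [N.Normal] (hN : N ≠ ⊥) : ∃ w ∈ N, w ∈ center G ∧ orderOf w = p := by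
  have hp := (Fact.out : p.Prime)
  have hconj : IsPGroup p (ConjAct G) := hG.of_equiv ConjAct.toConjAct
  have hNt : Nontrivial N := (nontrivial_iff_ne_bot N).mpr hN
  obtain ⟨n, hn, hc⟩ := (hG.to_subgroup N).nontrivial_iff_card.mp hNt
  obtain ⟨b, hb, hb1⟩ := hconj.exists_fixed_point_of_prime_dvd_card_of_fixed_point N
    (hc ▸ dvd_pow_self p hn.ne') (a := 1) (fun g => smul_one g)
  have hbc : (b : G) ∈ center G := by
    rw [mem_center_iff]
    intro g
    have := congrArg Subtype.val (hb (ConjAct.toConjAct g))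
    rw [ConjAct.Subgroup.val_conj_smul, ConjAct.toConjAct_smul] at this
    rw [mul_inv_eq_iff_eq_mul] at this
    exact this
  have hbne : (b : G) ^ p ^ 0 ≠ 1 := by
    rw [pow_zero, pow_one]
    exact fun h => hb1 (Subtype.ext h.symm)
  have hH : IsPGroup p (N ⊓ center G : Subgroup G) := hG.to_subgroup _
  obtain ⟨y, hy⟩ := hH.exists_orderOf_eq_pow_succ (j := 0) (x := ⟨b, b.2, hbc⟩)
    (fun h => hbne (congrArg Subtype.val h))
  refine ⟨y, y.2.1, y.2.2, ?_⟩
  rw [Subgroup.orderOf_coe, hy, zero_add, pow_one]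

lemma card_eq_card_center_mul (G : Type*) [Group G] :
    Nat.card G = Nat.card (center G) * Nat.card (G ⧸ center G) := by
  rw [mul_comm]
  exact card_eq_card_quotient_mul_card_subgroup _

lemma IsPGroup.le_card_of_nontrivial {G : Type*} [Group G] [Finite G] [Nontrivial G]
    (hG : IsPGroup p G) : p ≤ Nat.card G := by
  obtain ⟨n, hn, hc⟩ := hG.nontrivial_iff_card.mp inferInstance
  rw [hc]
  exact Nat.le_self_pow hn.ne' p

lemma not_isCyclic_quotient_center {G : Type*} [Group G] (h : ¬ ∀ a b : G, a * b = b * a) :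
    ¬ IsCyclic (G ⧸ center G) := by
  intro hc
  have := MonoidHom.isMulCommutative_of_isCyclic_of_ker_le_center (QuotientGroup.mk' (center G))
    (by rw [QuotientGroup.ker_mk'])
  exact h this.is_comm.comm

lemma IsPGroup.sq_le_card_of_not_isCyclic {G : Type*} [Group G] [Finite G]
    (hG : IsPGroup p G) (h : ¬ IsCyclic G) : p ^ 2 ≤ Nat.card G := by
  have hp := (Fact.out : p.Prime)
  obtain ⟨n, hn⟩ := IsPGroup.iff_card.mp hG
  rw [hn]
  apply Nat.pow_le_pow_right hp.pos
  by_contra! hlt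
  interval_cases n
  · have : Subsingleton G := Finite.card_le_one_iff_subsingleton.mp (by rw [hn]; simp)
    exact h inferInstance
  · exact h (isCyclic_of_prime_card (p := p) (by rw [hn, pow_one]))

lemma not_comm_of_two_le_nilpotencyClass {G : Type*} [Group G] [Group.IsNilpotent G]
    (h : 2 ≤ Group.nilpotencyClass G) : ¬ ∀ a b : G, a * b = b * a := by
  intro hc
  have h1 : Group.nilpotencyClass G ≤ 1 :=
    Group.IsNilpotent.nilpotencyClass_le_one_iff.mpr ⟨⟨hc⟩⟩
  omega

/-- The central quotient of a finite `p`-group of class `c ≥ 2` has order at least `p ^ c`. -/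
lemma IsPGroup.pow_nilpotencyClass_le_card_quotient_center (c : ℕ) (hc : 2 ≤ c) :
    ∀ (G : Type*) [Group G] [Finite G] [Group.IsNilpotent G], IsPGroup p G →
      Group.nilpotencyClass G = c → p ^ c ≤ Nat.card (G ⧸ center G) := by
  induction c, hc using Nat.le_induction with
  -- The bound starts at `c = 2`: the quotient is trivial for abelian groups, and otherwise
  -- noncyclic, which gains the second factor `p` at once.
  | base =>
    intro G _ _ _ hG hcl
    exact (hG.to_quotient _).sq_le_card_of_not_isCyclic
      (not_isCyclic_quotient_center (not_comm_of_two_le_nilpotencyClass hcl.ge))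
  | succ c hc ih =>
    intro G _ _ _ hG hcl
    have h1 : Group.nilpotencyClass (G ⧸ center G) = c := by
      rw [Group.nilpotencyClass_quotient_center, hcl, Nat.add_sub_cancel]
    have hnt : Nontrivial (G ⧸ center G) := by
      by_contra h
      rw [not_nontrivial_iff_subsingleton] at h
      rw [Group.nilpotencyClass_zero_iff_subsingleton.mpr h] at h1
      omega
    have hQ := hG.to_quotient (center G)
    have hZ : Nontrivial (center (G ⧸ center G)) := hQ.center_nontrivial
    rw [card_eq_card_center_mul (G ⧸ center G), pow_succ']
    exact Nat.mul_le_mul (hQ.to_subgroup _).le_card_of_nontrivial (ih _ hQ h1)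

/-- The derived subgroup of a finite `p`-group of class `c ≥ 1` has order at least
`p ^ (c - 1)`. -/
lemma IsPGroup.pow_le_card_commutator (c : ℕ) :
    ∀ (G : Type*) [Group G] [Finite G] [Group.IsNilpotent G], IsPGroup p G →
      Group.nilpotencyClass G = c + 1 → p ^ c ≤ Nat.card (commutator G) := by
  induction c with
  | zero =>
    intro G _ _ _ _ _
    rw [pow_zero]
    exact Nat.card_pos
  | succ c ih =>
    intro G _ _ _ hG hcl
    have h1 : Group.nilpotencyClass (G ⧸ center G) = c + 1 := by
      rw [Group.nilpotencyClass_quotient_center, hcl, Nat.add_sub_cancel]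
    have hne : commutator G ≠ ⊥ := by
      intro h
      refine not_comm_of_two_le_nilpotencyClass (G := G) (by omega) fun a b => ?_
      have hab := commutator_mem_commutator (mem_top a) (mem_top b)
      rw [← _root_.commutator_def, h, mem_bot] at hab
      exact commutatorElement_eq_one_iff_mul_comm.mp hab
    -- The derived subgroup meets the center nontrivially, so passing to `G / Z(G)` loses at least a
    -- factor `p`.
    obtain ⟨w, hw, hwZ, hwp⟩ := hG.exists_mem_center_of_normal hne
    have hmap : (commutator G).map (QuotientGroup.mk' (center G)) = commutator (G ⧸ center G) := by
      rw [_root_.commutator_def, map_commutator, _root_.commutator_def,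
        map_top_of_surjective _ (QuotientGroup.mk'_surjective _)]
    have ih' := ih _ (hG.to_quotient (center G)) h1
    rw [← hmap] at ih'
    let f := ((QuotientGroup.mk' (center G)).subgroupMap (commutator G))
    have hf : Function.Surjective f := MonoidHom.subgroupMap_surjective _ _
    have hcard : Nat.card (commutator G) =
        Nat.card ((commutator G).map (QuotientGroup.mk' (center G))) * Nat.card f.ker := by
      rw [← card_mul_index f.ker, index_ker, MonoidHom.range_eq_top.mpr hf, card_top, mul_comm]
    rw [hcard, pow_succ]
    refine Nat.mul_le_mul ih' ?_
    have hmem : (⟨w, hw⟩ : commutator G) ∈ f.ker := by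
      rw [MonoidHom.mem_ker]
      exact Subtype.ext ((QuotientGroup.eq_one_iff w).mpr hwZ)
    have := card_le_of_le (zpowers_le.mpr hmem)
    rwa [Nat.card_zpowers, ← Subgroup.orderOf_coe, hwp] at this

lemma card_secondCenterQuot_mul (G : Type*) [Group G] :
    Nat.card (secondCenter G) = Nat.card (SecondCenterQuot G) * Nat.card (center G) := by
  have hle : center G ≤ secondCenter G := by
    rw [← Subgroup.upperCentralSeries_one]
    exact Subgroup.upperCentralSeries_mono G one_le_two
  rw [card_eq_card_quotient_mul_card_subgroup ((center G).subgroupOf (secondCenter G)),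
    Nat.card_congr (subgroupOfEquivOfLe hle).toEquiv]

lemma card_eq_mul_secondCenterQuot_mul (G : Type*) [Group G] :
    Nat.card G = Nat.card (center G) * Nat.card (SecondCenterQuot G) *
      Nat.card ((G ⧸ center G) ⧸ center (G ⧸ center G)) := by
  have h : (center (G ⧸ center G)).comap (QuotientGroup.mk' (center G)) = secondCenter G := by
    rw [← Subgroup.upperCentralSeries_one (G ⧸ center G),
      Subgroup.comap_upperCentralSeries_quotient_center]
  rw [← card_mul_index (secondCenter G), card_secondCenterQuot_mul, ← h,
    index_comap_of_surjective _ (QuotientGroup.mk'_surjective _), mul_comm (Nat.card (center G))]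
  rfl

end NilpotentOrders

/-! ### Central automorphisms and the commutator pairing. -/

section CentralAutomorphisms

open Subgroup
open scoped commutatorElement IsMulCommutative

lemma commutator_mem_center_of_mem_secondCenter {G : Type*} [Group G] {g : G}
    (hg : g ∈ secondCenter G) (x : G) : ⁅g, x⁆ ∈ center G := by
  rw [← Subgroup.upperCentralSeries_one]
  exact Subgroup.mem_upperCentralSeries_succ_iff.mp hg x

lemma mem_secondCenter_of_forall {G : Type*} [Group G] {g : G}
    (h : ∀ x, ⁅g, x⁆ ∈ center G) : g ∈ secondCenter G := by
  refine Subgroup.mem_upperCentralSeries_succ_iff.mpr fun x => ?_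
  rw [Subgroup.upperCentralSeries_one]
  exact h x

/-- The pairing `(g, x) ↦ [g, x]` of the second center with `G`, with values in the center. -/
def centerPairing (G : Type*) [Group G] : secondCenter G →* (G →* center G) :=
  MonoidHom.mk'
    (fun g => MonoidHom.mk'
      (fun x => ⟨⁅(g : G), x⁆, commutator_mem_center_of_mem_secondCenter g.2 x⟩)
      (fun x y => Subtype.ext (by
        have h := mem_center_iff.mp (commutator_mem_center_of_mem_secondCenter g.2 y)
        change ⁅(g : G), x * y⁆ = ⁅(g : G), x⁆ * ⁅(g : G), y⁆
        calc ⁅(g : G), x * y⁆ = ⁅(g : G), x⁆ * (x * ⁅(g : G), y⁆) * x⁻¹ := by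
              simp only [commutatorElement_def]; group
          _ = _ := by rw [h x]; group)))
    (fun g h => by
      ext x
      have hc := mem_center_iff.mp (commutator_mem_center_of_mem_secondCenter h.2 x)
      change ⁅(g : G) * h, x⁆ = ⁅(g : G), x⁆ * ⁅(h : G), x⁆
      calc ⁅(g : G) * h, x⁆ = (g * ⁅(h : G), x⁆) * x * (g : G)⁻¹ * x⁻¹ := by
            simp only [commutatorElement_def]; group
        _ = ⁅(h : G), x⁆ * ⁅(g : G), x⁆ := by
            rw [hc g]; simp only [commutatorElement_def]; group
        _ = _ := (hc _).symm)

lemma coe_centerPairing_apply {G : Type*} [Group G] (g : secondCenter G) (x : G) :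
    (centerPairing G g x : G) = ⁅(g : G), x⁆ := rfl

lemma ker_centerPairing (G : Type*) [Group G] :
    (centerPairing G).ker = (center G).subgroupOf (secondCenter G) := by
  ext g
  rw [MonoidHom.mem_ker, mem_subgroupOf, mem_center_iff]
  constructor
  · intro h x
    have := congrArg Subtype.val (DFunLike.congr_fun h x)
    exact (commutatorElement_eq_one_iff_mul_comm.mp this).symm
  · intro h
    ext x
    exact commutatorElement_eq_one_iff_mul_comm.mpr (h x).symm

/-- `Z₂(G) / Z(G)` is isomorphic to the range of the commutator pairing. -/
noncomputable def secondCenterQuotEquivRange (G : Type*) [Group G] :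
    SecondCenterQuot G ≃* (centerPairing G).range :=
  (QuotientGroup.quotientMulEquivOfEq (ker_centerPairing G).symm).trans
    (QuotientGroup.quotientKerEquivRange _)

/-- Conjugations by `g` and `x` commute exactly when conjugation by `[g, x]` is trivial, that is,
when `[g, x]` is central. -/
lemma mem_centerInnerAut_iff {G : Type*} [Group G] {α : MulAut G} :
    α ∈ centerInnerAut G ↔ ∃ g ∈ secondCenter G, α = MulAut.conj g := by
  constructor
  · rintro ⟨⟨_, g, rfl⟩, hc, rfl⟩
    refine ⟨g, mem_secondCenter_of_forall fun x => mem_center_iff.mpr fun y => ?_, rfl⟩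
    have h := congrArg Subtype.val (mem_center_iff.mp hc ⟨MulAut.conj x, x, rfl⟩)
    change MulAut.conj x * MulAut.conj g = MulAut.conj g * MulAut.conj x at h
    have h1 : MulAut.conj ⁅g, x⁆ = 1 := by
      rw [map_commutatorElement, commutatorElement_eq_one_iff_mul_comm, h]
    have h2 := DFunLike.congr_fun h1 y
    rw [MulAut.conj_apply, MulAut.one_apply, mul_inv_eq_iff_eq_mul] at h2
    exact h2.symm
  · rintro ⟨g, hg, rfl⟩
    refine ⟨⟨MulAut.conj g, g, rfl⟩, mem_center_iff.mpr ?_, rfl⟩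
    rintro ⟨_, x, rfl⟩
    apply Subtype.ext
    change MulAut.conj x * MulAut.conj g = MulAut.conj g * MulAut.conj x
    have h1 : MulAut.conj ⁅g, x⁆ = 1 := by
      ext y
      have := mem_center_iff.mp (commutator_mem_center_of_mem_secondCenter hg x) y
      rw [MulAut.conj_apply, MulAut.one_apply, ← this, mul_inv_cancel_right]
    rw [map_commutatorElement, commutatorElement_eq_one_iff_mul_comm] at h1
    exact h1.symm

lemma centerInnerAut_le_centralAut (G : Type*) [Group G] : centerInnerAut G ≤ centralAut G := by
  intro α hα
  obtain ⟨g, hg, rfl⟩ := mem_centerInnerAut_iff.mp hα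
  intro x
  have h := commutator_mem_center_of_mem_secondCenter hg x
  have h2 := mem_center_iff.mp h x⁻¹
  rw [MulAut.conj_apply]
  have : x⁻¹ * (g * x * g⁻¹) = x⁻¹ * ⁅g, x⁆ * x := by
    rw [commutatorElement_def]; group
  rw [this, h2, inv_mul_cancel_right]
  exact h

/-- The central automorphism `x ↦ x f(x)` attached to a homomorphism `f : G → Z(G)` with
`f(z) ≠ z⁻¹` for `1 ≠ z ∈ Z(G)`. -/
noncomputable def centralAutOfHom {G : Type*} [Group G] [Finite G] (f : G →* center G)
    (hf : ∀ z : center G, f z = z⁻¹ → z = 1) : MulAut G :=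
  MulEquiv.ofBijective
    (MonoidHom.mk' (fun x => x * (f x : G)) (fun x y => by
      have h := mem_center_iff.mp (f x).2 y
      rw [map_mul, Subgroup.coe_mul]
      calc x * y * (f x * f y) = x * (y * f x) * f y := by group
        _ = _ := by rw [h]; group))
    (Finite.injective_iff_bijective.mp ((injective_iff_map_eq_one _).mpr fun x hx => by
      change x * (f x : G) = 1 at hx
      have hx1 : x = (((f x)⁻¹ : center G) : G) := by
        rw [Subgroup.coe_inv]; exact eq_inv_of_mul_eq_one_left hx
      have := hf (f x)⁻¹ (by rw [← hx1, inv_inv])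
      rw [hx1, this, Subgroup.coe_one]))

lemma centralAutOfHom_apply {G : Type*} [Group G] [Finite G] (f : G →* center G)
    (hf : ∀ z : center G, f z = z⁻¹ → z = 1) (x : G) :
    centralAutOfHom f hf x = x * (f x : G) := rfl

/-- If `Aut_z(G) = Z(Inn(G))`, then every homomorphism `f : G → Z(G)` defining a central
automorphism is of the form `x ↦ [g, x]`. -/
lemma mem_range_centerPairing_of_eq {G : Type*} [Group G] [Finite G]
    (h : centralAut G = centerInnerAut G) (f : G →* center G)
    (hf : ∀ z : center G, f z = z⁻¹ → z = 1) : f ∈ (centerPairing G).range := by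
  have hmem : centralAutOfHom f hf ∈ centralAut G := by
    intro x
    rw [centralAutOfHom_apply, inv_mul_cancel_left]
    exact (f x).2
  rw [h, mem_centerInnerAut_iff] at hmem
  obtain ⟨g, hg, hα⟩ := hmem
  refine ⟨⟨g, hg⟩, ?_⟩
  ext x
  have h1 := DFunLike.congr_fun hα x
  rw [centralAutOfHom_apply, MulAut.conj_apply] at h1
  rw [coe_centerPairing_apply]
  change ⁅g, x⁆ = _
  have h2 := mem_center_iff.mp (f x).2 x
  rw [commutatorElement_def, ← h1, h2, mul_inv_cancel_right]

/-- For a central automorphism `α`, the map `x ↦ α(x) x⁻¹` is a homomorphism to the center; writing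
it as `x ↦ [g, x]` makes `α` conjugation by `g`. -/
lemma eq_of_range_centerPairing_eq_top {G : Type*} [Group G]
    (h : (centerPairing G).range = ⊤) : centralAut G = centerInnerAut G := by
  refine le_antisymm (fun α hα => ?_) (centerInnerAut_le_centralAut G)
  have hα' (x : G) : α x * x⁻¹ ∈ center G := by
    have h1 := mem_center_iff.mp (hα x) x
    have : α x * x⁻¹ = x⁻¹ * α x := by
      rw [mul_inv_eq_iff_eq_mul, ← h1, mul_inv_cancel_left]
    exact this ▸ hα x
  let f : G →* center G := MonoidHom.mk' (fun x => ⟨α x * x⁻¹, hα' x⟩) (fun x y => by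
    apply Subtype.ext
    have h1 := mem_center_iff.mp (hα' y) (x⁻¹)
    change α (x * y) * (x * y)⁻¹ = α x * x⁻¹ * (α y * y⁻¹)
    rw [mul_assoc (α x), h1, map_mul]
    group)
  obtain ⟨g, hg⟩ : f ∈ (centerPairing G).range := h ▸ mem_top f
  refine mem_centerInnerAut_iff.mpr ⟨g, g.2, ?_⟩
  ext x
  have h1 := congrArg Subtype.val (DFunLike.congr_fun hg x)
  change g * x * (g : G)⁻¹ * x⁻¹ = α x * x⁻¹ at h1
  exact (mul_right_cancel h1).symm

variable {p : ℕ} [Fact p.Prime]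

/-- In a nonabelian finite `p`-group with cyclic center, every homomorphism to the center defines a
central automorphism. -/
lemma IsPGroup.eq_one_of_map_eq_inv {G : Type*} [Group G] [Finite G] (hG : IsPGroup p G)
    (hcyc : IsCyclic (center G)) (hna : ¬ ∀ a b : G, a * b = b * a) (f : G →* center G)
    (z : center G) (hz : f z = z⁻¹) : z = 1 := by
  have hp := (Fact.out : p.Prime)
  have hne : commutator G ≠ ⊥ := by
    intro h
    refine hna fun a b => ?_
    have hab := commutator_mem_commutator (mem_top a) (mem_top b)
    rw [← _root_.commutator_def, h, mem_bot] at hab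
    exact commutatorElement_eq_one_iff_mul_comm.mp hab
  obtain ⟨w, hw, hwZ, hwp⟩ := hG.exists_mem_center_of_normal hne
  by_contra hz1
  obtain ⟨e, he⟩ := (IsPGroup.iff_orderOf.mp (hG.to_subgroup (center G))) z
  obtain ⟨j, rfl⟩ : ∃ j, e = j + 1 := by
    refine Nat.exists_eq_succ_of_ne_zero ?_
    rintro rfl
    exact hz1 (orderOf_eq_one_iff.mp (by rw [he, pow_zero]))
  set y := z ^ p ^ j with hy
  have hyp : orderOf y = p := by
    rw [hy, orderOf_pow_of_dvd (pow_pos hp.pos _).ne' (he ▸ pow_dvd_pow p j.le_succ), he, pow_succ,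
      Nat.mul_div_cancel_left _ (pow_pos hp.pos _)]
  have hfy : f y = y⁻¹ := by rw [hy, Subgroup.coe_pow, map_pow, hz, inv_pow]
  have hww : orderOf (⟨w, hwZ⟩ : center G) = p := by
    rw [← hwp, ← Subgroup.orderOf_coe]
  -- A cyclic center has only one subgroup of order `p`, so the power `y` of `z` lies in `⟨w⟩ ≤ G'`,
  -- where `f` is trivial. This contradicts `f y = y⁻¹ ≠ 1`.
  have hker (u : center G) (hu : orderOf u = p) :
      zpowers u = (powMonoidHom p : center G →* center G).ker := by
    apply eq_of_le_of_card_ge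
    · rw [zpowers_le, MonoidHom.mem_ker, powMonoidHom_apply, ← hu, pow_orderOf_eq_one]
    · rw [Nat.card_zpowers, hu, IsCyclic.card_powMonoidHom_ker]
      exact Nat.gcd_le_right _ hp.pos
  have hzp : zpowers y = zpowers (⟨w, hwZ⟩ : center G) := by rw [hker y hyp, hker _ hww]
  have hyw : y ∈ zpowers (⟨w, hwZ⟩ : center G) := hzp ▸ mem_zpowers y
  obtain ⟨k, hk⟩ := hyw
  have hfw : f w = 1 := Abelianization.commutator_subset_ker f hw
  have hy1 : f y = 1 := by
    rw [← hk]
    change f (w ^ k) = 1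
    rw [map_zpow, hfw, one_zpow]
  rw [hy1] at hfy
  have : y = 1 := inv_eq_one.mp hfy.symm
  rw [this, orderOf_one] at hyp
  exact hp.one_lt.ne hyp

lemma card_range_centerPairing (G : Type*) [Group G] :
    Nat.card (centerPairing G).range = Nat.card (SecondCenterQuot G) :=
  (Nat.card_congr (secondCenterQuotEquivRange G).toEquiv).symm

lemma IsPGroup.centralAut_eq_iff_range_eq_top {G : Type*} [Group G] [Finite G] (hG : IsPGroup p G)
    (hcyc : IsCyclic (center G)) (hna : ¬ ∀ a b : G, a * b = b * a) :
    centralAut G = centerInnerAut G ↔ (centerPairing G).range = ⊤ := by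
  refine ⟨fun h => top_le_iff.mp fun f _ => ?_, eq_of_range_centerPairing_eq_top⟩
  exact mem_range_centerPairing_of_eq h f (hG.eq_one_of_map_eq_inv hcyc hna f)

lemma IsPGroup.nonempty_mulEquiv_of_centralAut_eq {G : Type*} [Group G] [Finite G]
    (hG : IsPGroup p G) (hcyc : IsCyclic (center G)) (hna : ¬ ∀ a b : G, a * b = b * a)
    (h : centralAut G = centerInnerAut G) :
    Nonempty (SecondCenterQuot G ≃* Abelianization G ⧸
      (powMonoidHom (Nat.card (center G)) : Abelianization G →* Abelianization G).range) := by
  obtain ⟨e⟩ := nonempty_monoidHom_mulEquiv_abelianization_quotient G (center G)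
  have htop := (hG.centralAut_eq_iff_range_eq_top hcyc hna).mp h
  exact ⟨((secondCenterQuotEquivRange G).trans
    ((MulEquiv.subgroupCongr htop).trans topEquiv)).trans e⟩

/-- The index is `|Hom(G, Z(G))|` and the image of the pairing has the order of `Z₂(G) / Z(G)`, so
the inequality forces surjectivity. -/
lemma centralAut_eq_of_index_le {G : Type*} [Group G] [Finite G]
    (hcyc : IsCyclic (center G))
    (h : (powMonoidHom (Nat.card (center G)) : Abelianization G →* Abelianization G).range.index ≤
      Nat.card (SecondCenterQuot G)) : centralAut G = centerInnerAut G := by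
  have : Finite (G →* center G) := DFunLike.finite _
  apply eq_of_range_centerPairing_eq_top
  apply eq_top_of_le_card
  rwa [card_range_centerPairing, card_monoidHom_eq_index]

/-- Elements of `Z₂(G) / Z(G)` are killed by any number killing the commutators. -/
lemma secondCenterQuot_pow_eq_one {G : Type*} [Group G] {q : ℕ}
    (h : ∀ z ∈ commutator G, z ∈ center G → z ^ q = 1) (b : SecondCenterQuot G) : b ^ q = 1 := by
  apply (secondCenterQuotEquivRange G).injective
  rw [map_pow, map_one]
  obtain ⟨f, g, rfl⟩ := secondCenterQuotEquivRange G b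
  ext x
  change ⁅(g : G), x⁆ ^ q = 1
  exact h _ (commutator_mem_commutator (mem_top _) (mem_top _))
    (commutator_mem_center_of_mem_secondCenter g.2 x)

end CentralAutomorphisms

/-! ### Class two, noncyclic centers, and order bounds in coclass four. -/

section CoclassFour

open Subgroup
open scoped commutatorElement IsMulCommutative

lemma commutator_le_center_of_secondCenter_eq_top {G : Type*} [Group G] (h2 : secondCenter G = ⊤) :
    commutator G ≤ center G := by
  rw [_root_.commutator_def, commutator_le]
  intro a _ b _
  exact commutator_mem_center_of_mem_secondCenter (h2 ▸ mem_top a) b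

/-- A finite group has a self-centralizing abelian subgroup. -/
lemma exists_centralizer_eq_self (G : Type*) [Group G] [Finite G] :
    ∃ M : Subgroup G, centralizer (M : Set G) = M := by
  obtain ⟨M, hM⟩ := (Set.toFinite {M : Subgroup G | M ≤ centralizer (M : Set G)}).exists_maximal
    ⟨⊥, Set.mem_ofPred.mpr bot_le⟩
  refine ⟨M, le_antisymm (fun g hg => ?_) hM.1⟩
  have hle : M ⊔ zpowers g ≤ centralizer ((M ⊔ zpowers g : Subgroup G) : Set G) := by
    have h1 : M ≤ centralizer (zpowers g : Set G) := by
      rw [le_centralizer_iff, zpowers_le]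
      exact hg
    have h2 : zpowers g ≤ centralizer (zpowers g : Set G) := by
      rw [le_centralizer_iff_isMulCommutative]
      infer_instance
    rw [sup_eq_closure, centralizer_closure, ← sup_eq_closure]
    refine sup_le (fun x hx => ?_) (fun x hx => ?_)
    · rw [mem_centralizer_iff]
      rintro y (hy | hy)
      · exact mem_centralizer_iff.mp (hM.1 hx) y hy
      · exact mem_centralizer_iff.mp (h1 hx) y hy
    · rw [mem_centralizer_iff]
      rintro y (hy | hy)
      · exact (mem_centralizer_iff.mp (h1 hy) x hx).symm
      · exact mem_centralizer_iff.mp (h2 hx) y hy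
  exact hM.2 hle le_sup_left (mem_sup_right (mem_zpowers g))

/-- In a finite group of class at most two with cyclic center, the center has square index. -/
lemma exists_index_center_eq_mul_self {G : Type*} [Group G] [Finite G]
    (h2 : secondCenter G = ⊤) (hcyc : IsCyclic (center G)) :
    ∃ s, (center G).index = s * s := by
  obtain ⟨M, hM⟩ := exists_centralizer_eq_self G
  have hZM : center G ≤ M := hM ▸ center_le_centralizer _
  have hN : M.Normal := Normal.of_commutator_le _
    ((commutator_le_center_of_secondCenter_eq_top h2).trans hZM)
  have hcent (x : G) : x ∈ M ↔ ∀ y ∈ M, ⁅x, y⁆ = 1 := by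
    conv_lhs => rw [← hM, mem_centralizer_iff]
    simp only [commutatorElement_eq_one_iff_mul_comm, SetLike.mem_coe]
    exact forall₂_congr fun y _ => eq_comm
  let β : G →* (G →* center G) :=
    (centerPairing G).comp ((MulEquiv.subgroupCongr h2).trans topEquiv).symm.toMonoidHom
  have hβ (x y : G) : (β x y : G) = ⁅x, y⁆ := rfl
  -- Commutation pairs `M / Z(G)` with `G / M`, nondegenerately on both sides as `M` is its own
  -- centralizer. The two index bounds give `|M : Z(G)| = |G : M|`.
  let β₁ : M →* (G →* center G) := β.comp M.subtype
  let β₂ : G →* (M →* center G) := (MonoidHom.compHom' M.subtype).comp β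
  have h1 : β₁.ker.index ≤ M.index := by
    apply index_ker_le_of_pairing
    intro x y hy
    exact Subtype.ext ((hcent x).mp x.2 y hy)
  have h1' : β₁.ker = (center G).subgroupOf M := by
    ext x
    rw [MonoidHom.mem_ker, mem_subgroupOf, mem_center_iff]
    constructor
    · intro h y
      have := congrArg Subtype.val (DFunLike.congr_fun h y)
      exact (commutatorElement_eq_one_iff_mul_comm.mp this).symm
    · intro h
      ext y
      exact commutatorElement_eq_one_iff_mul_comm.mpr (h y).symm
  have h3 : β₂.ker.index ≤ ((center G).subgroupOf M).index := by
    apply index_ker_le_of_pairing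
    intro x y hy
    apply Subtype.ext
    exact commutatorElement_eq_one_iff_mul_comm.mpr (mem_center_iff.mp (mem_subgroupOf.mp hy) x)
  have h3' : β₂.ker = M := by
    ext x
    rw [MonoidHom.mem_ker, hcent]
    constructor
    · intro h y hy
      exact congrArg Subtype.val (DFunLike.congr_fun h ⟨y, hy⟩)
    · intro h
      ext y
      exact h y y.2
  rw [h1'] at h1
  rw [h3'] at h3
  refine ⟨M.index, ?_⟩
  rw [← relIndex_mul_index hZM, relIndex, le_antisymm h1 h3]

lemma HasCoclass.isPGroup {p : ℕ} {G : Type*} [Group G] {k : ℕ} (hG : HasCoclass p G k) :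
    IsPGroup p G := by
  obtain ⟨-, n, hn, -⟩ := hG
  exact IsPGroup.of_card hn

variable {p : ℕ} [Fact p.Prime]

/-- `A^p` lies in the Frattini subgroup, so dividing by it preserves the rank and leaves an
elementary abelian group. -/
lemma IsPGroup.index_range_powMonoidHom_eq_pow_rank {A : Type*} [CommGroup A] [Finite A]
    (hA : IsPGroup p A) :
    Group.rank (A ⧸ (powMonoidHom p : A →* A).range) = Group.rank A ∧
    (powMonoidHom p : A →* A).range.index = p ^ Group.rank A := by
  have h : Group.rank A = Group.rank (A ⧸ (powMonoidHom p : A →* A).range) := by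
    apply Group.rank_eq_of_ker_le_frattini (QuotientGroup.mk' _) (QuotientGroup.mk'_surjective _)
    rw [QuotientGroup.ker_mk']
    rintro _ ⟨x, rfl⟩
    exact hA.pow_mem_frattini x
  refine ⟨h.symm, ?_⟩
  rw [h]
  refine Group.card_eq_pow_rank_of_elementary (fun x => ?_)
  obtain ⟨a, rfl⟩ := QuotientGroup.mk'_surjective _ x
  rw [← map_pow]
  exact (QuotientGroup.eq_one_iff (N := (powMonoidHom p : A →* A).range) (a ^ p)).mpr ⟨a, rfl⟩

lemma IsPGroup.rank_abelianization {G : Type*} [Group G] [Finite G] (hG : IsPGroup p G) :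
    Group.rank (Abelianization G) = Group.rank G := by
  refine (Group.rank_eq_of_ker_le_frattini Abelianization.of
    (QuotientGroup.mk'_surjective (commutator G)) ?_).symm
  rw [Abelianization.ker_of]
  exact hG.commutator_le_frattini

lemma exists_monoidHom_cyc_of_orderOf {Z : Type*} [Group Z] {w : Z} (hw : orderOf w = p) :
    ∃ ψ : Cyc p →* Z, Function.Injective ψ ∧ ψ.range = zpowers w := by
  have hc : Nat.card (Cyc p) = Nat.card (zpowers w) := by rw [card_cyc, Nat.card_zpowers, hw]
  let e : Cyc p ≃* zpowers w := mulEquivOfCyclicCardEq hc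
  refine ⟨(zpowers w).subtype.comp e.toMonoidHom, Subtype.val_injective.comp e.injective, ?_⟩
  rw [MonoidHom.range_comp, MonoidHom.range_eq_top.mpr e.surjective, ← MonoidHom.range_eq_map,
    range_subtype]

/-- If `Aut_z(G) = Z(Inn(G))`, then homomorphisms from `G` to a group of order `p` are trivial on
the center. -/
lemma IsPGroup.map_center_eq_one_of_centralAut_eq {G : Type*} [Group G] [Finite G]
    (hG : IsPGroup p G) (hcard : p < Nat.card G) (h : centralAut G = centerInnerAut G)
    (χ : G →* Cyc p) (z : center G) : χ z = 1 := by
  have hp := (Fact.out : p.Prime)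
  have : NeZero p := ⟨hp.ne_zero⟩
  have hker : χ.ker ≠ ⊥ := by
    intro hb
    have := Nat.card_le_card_of_injective χ ((MonoidHom.ker_eq_bot_iff χ).mp hb)
    rw [card_cyc] at this
    omega
  obtain ⟨w, hw, hwZ, hwp⟩ := hG.exists_mem_center_of_normal hker
  have hww : orderOf (⟨w, hwZ⟩ : center G) = p := by
    rw [← hwp, ← Subgroup.orderOf_coe]
  -- Choosing `w` inside `ker χ` makes `χ ∘ ψ` trivial, so `ψ ∘ χ` defines an automorphism. It is
  -- therefore some `x ↦ [g, x]`, which kills the center.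
  obtain ⟨ψ, hψ, hr⟩ := exists_monoidHom_cyc_of_orderOf hww
  have hχψ (a : Cyc p) : χ (ψ a) = 1 := by
    obtain ⟨k, hk⟩ : ψ a ∈ zpowers (⟨w, hwZ⟩ : center G) := hr ▸ ⟨a, rfl⟩
    rw [← hk]
    change χ (w ^ k) = 1
    rw [map_zpow, MonoidHom.mem_ker.mp hw, one_zpow]
  obtain ⟨g, hg⟩ := mem_range_centerPairing_of_eq h (ψ.comp χ) (fun u hu => by
    rw [MonoidHom.comp_apply] at hu
    have h1 : χ u = 1 := by
      have := hχψ (χ u)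
      rw [hu, Subgroup.coe_inv, map_inv, inv_eq_one] at this
      exact this
    rw [h1, map_one] at hu
    exact inv_eq_one.mp hu.symm)
  apply hψ
  rw [map_one]
  have h1 := DFunLike.congr_fun hg (z : G)
  rw [MonoidHom.comp_apply] at h1
  rw [← h1]
  exact Subtype.ext (commutatorElement_eq_one_iff_mul_comm.mpr (mem_center_iff.mp z.2 g))

lemma IsPGroup.exists_orderOf_eq_prime_of_nontrivial {Z : Type*} [Group Z] (hZ : IsPGroup p Z)
    [Nontrivial Z] : ∃ w : Z, orderOf w = p := by
  obtain ⟨x, hx⟩ := exists_ne (1 : Z)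
  obtain ⟨y, hy⟩ := hZ.exists_orderOf_eq_pow_succ (j := 0) (x := x) (by simpa using hx)
  exact ⟨y, by rw [hy, zero_add, pow_one]⟩

/-- A noncyclic abelian `p`-group has more than `p` elements killed by `p`, hence two subgroups of
order `p` meeting trivially. -/
lemma IsPGroup.exists_disjoint_monoidHom_cyc {Z : Type*} [CommGroup Z] [Finite Z]
    (hZ : IsPGroup p Z) (hcyc : ¬ IsCyclic Z) :
    ∃ ψ₁ ψ₂ : Cyc p →* Z, Function.Injective ψ₁ ∧ Function.Injective ψ₂ ∧
      ∀ a b, ψ₁ a = ψ₂ b → b = 1 := by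
  have hp := (Fact.out : p.Prime)
  have hnt : Nontrivial Z := by
    by_contra hn
    rw [not_nontrivial_iff_subsingleton] at hn
    exact hcyc inferInstance
  obtain ⟨w₁, hw₁⟩ := hZ.exists_orderOf_eq_prime_of_nontrivial
  have hlt : ¬ (powMonoidHom p : Z →* Z).ker ≤ zpowers w₁ := by
    intro hle
    have h1 := card_le_of_le hle
    rw [Nat.card_zpowers, hw₁, ← index_range, hZ.index_range_powMonoidHom_eq_pow_rank.2] at h1
    refine hcyc (Group.isCyclic_of_rank_le_one ?_)
    by_contra! h2
    have h3 : p ^ 1 < p ^ Group.rank Z := Nat.pow_lt_pow_right hp.one_lt h2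
    rw [pow_one] at h3
    omega
  obtain ⟨w₂, hw₂, hn⟩ := SetLike.not_le_iff_exists.mp hlt
  have hw₂p : orderOf w₂ = p := orderOf_eq_prime hw₂ (fun h => hn (h ▸ one_mem _))
  obtain ⟨ψ₁, h₁, r₁⟩ := exists_monoidHom_cyc_of_orderOf hw₁
  obtain ⟨ψ₂, h₂, r₂⟩ := exists_monoidHom_cyc_of_orderOf hw₂p
  refine ⟨ψ₁, ψ₂, h₁, h₂, fun a b hab => ?_⟩
  by_contra hb
  obtain ⟨c, hc⟩ : w₂ ∈ ψ₂.range := r₂ ▸ mem_zpowers w₂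
  obtain ⟨k, hk⟩ := mem_zpowers_of_prime_card (card_cyc p) hb (g' := c)
  apply hn
  rw [← hc, ← hk]
  change ψ₂ (b ^ k) ∈ _
  rw [map_zpow, ← hab]
  exact zpow_mem (r₁ ▸ ⟨a, rfl⟩) k

/-- If `Aut_z(G) = Z(Inn(G))` and `Z(G)` is not cyclic, then `Z₂(G) / Z(G)` is large. -/
lemma IsPGroup.sq_card_monoidHom_le_of_centralAut_eq {G : Type*} [Group G] [Finite G]
    (hG : IsPGroup p G) (hcard : p < Nat.card G) (h : centralAut G = centerInnerAut G)
    (hcyc : ¬ IsCyclic (center G)) :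
    Nat.card (G →* Cyc p) ^ 2 ≤ Nat.card (SecondCenterQuot G) := by
  have hχ := hG.map_center_eq_one_of_centralAut_eq hcard h
  obtain ⟨ψ₁, ψ₂, h₁, h₂, hd⟩ := (hG.to_subgroup (center G)).exists_disjoint_monoidHom_cyc hcyc
  -- Both characters vanish on the center, so every such product defines a central automorphism, and
  -- disjoint images let the pair be recovered.
  let F (χ : (G →* Cyc p) × (G →* Cyc p)) : (centerPairing G).range :=
    ⟨ψ₁.comp χ.1 * ψ₂.comp χ.2, mem_range_centerPairing_of_eq h _ (fun z hz => by
      rw [MonoidHom.mul_apply, MonoidHom.comp_apply, MonoidHom.comp_apply, hχ, hχ, map_one,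
        map_one, mul_one] at hz
      exact inv_eq_one.mp hz.symm)⟩
  have hF : Function.Injective F := by
    rintro ⟨χ₁, χ₂⟩ ⟨χ₁', χ₂'⟩ heq
    have key (x : G) : χ₁ x = χ₁' x ∧ χ₂ x = χ₂' x := by
      have h3 : ψ₁ (χ₁ x) * ψ₂ (χ₂ x) = ψ₁ (χ₁' x) * ψ₂ (χ₂' x) :=
        DFunLike.congr_fun (congrArg Subtype.val heq) x
      have h4 : ψ₁ ((χ₁' x)⁻¹ * χ₁ x) = ψ₂ (χ₂' x * (χ₂ x)⁻¹) := by
        rw [map_mul, map_mul, map_inv, map_inv, eq_mul_inv_iff_mul_eq, mul_assoc, h3,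
          inv_mul_cancel_left]
      have h5 := mul_inv_eq_one.mp (hd _ _ h4)
      refine ⟨h₁ ?_, h5.symm⟩
      rw [h5] at h3
      exact mul_right_cancel h3
    exact Prod.ext (MonoidHom.ext fun x => (key x).1) (MonoidHom.ext fun x => (key x).2)
  rw [sq, ← Nat.card_prod, ← card_range_centerPairing]
  have : Finite (G →* center G) := DFunLike.finite _
  exact Nat.card_le_card_of_injective F hF

lemma card_monoidHom_cyc {G : Type*} [Group G] [Finite G] (hG : IsPGroup p G) :
    Nat.card (G →* Cyc p) = p ^ Group.rank G := by
  have : NeZero p := ⟨(Fact.out : p.Prime).ne_zero⟩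
  rw [card_monoidHom_eq_index, card_cyc, ← hG.rank_abelianization]
  exact (hG.to_quotient (commutator G)).index_range_powMonoidHom_eq_pow_rank.2

lemma two_le_rank_of_nonabelian {G : Type*} [Group G] [Finite G]
    (hna : ¬ ∀ a b : G, a * b = b * a) : 2 ≤ Group.rank G := by
  by_contra! h
  have := Group.isCyclic_of_rank_le_one (G := G) (by omega)
  let _ := IsCyclic.commGroup (α := G)
  exact hna mul_comm

lemma card_abelianization_mul (G : Type*) [Group G] :
    Nat.card (Abelianization G) * Nat.card (commutator G) = Nat.card G :=
  (card_eq_card_quotient_mul_card_subgroup (commutator G)).symm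

/-- Orders of the first two upper central factors of a nonabelian `p`-group of coclass `4`. -/
lemma HasCoclass.orders {G : Type*} [Group G] [Finite G] (hG : HasCoclass p G 4)
    (hna : ¬ ∀ a b : G, a * b = b * a) {k b : ℕ} (hk : Nat.card (center G) = p ^ k)
    (hb : Nat.card (SecondCenterQuot G) = p ^ b) :
    Nat.card (Abelianization G) ≤ p ^ 5 ∧
      (k + b ≤ 5 ∨ k + b = 6 ∧ secondCenter G = ⊤) := by
  have hp := (Fact.out : p.Prime)
  have hP := hG.isPGroup
  obtain ⟨hnil, n, hn, hc⟩ := hG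
  have hc2 : 2 ≤ Group.nilpotencyClass G := by
    by_contra! h
    exact hna (Group.IsNilpotent.nilpotencyClass_le_one_iff.mp (Nat.le_of_lt_succ h)).is_comm.comm
  constructor
  · obtain ⟨c, hc'⟩ : ∃ c, Group.nilpotencyClass G = c + 1 := ⟨_, (Nat.sub_add_cancel (by omega)).symm⟩
    have h1 := hP.pow_le_card_commutator c G hc'
    have h2 := card_abelianization_mul G
    have h3 : n = 5 + c := by omega
    rw [hn, h3, pow_add] at h2
    refine Nat.le_of_mul_le_mul_right ?_ (pow_pos hp.pos c)
    rw [← h2]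
    exact Nat.mul_le_mul_left _ h1
  -- In class two `|G| = p^6` and `Z₂(G) = G`. In class `c ≥ 3` the second central quotient has
  -- order at least `p^(c-1)`, leaving at most `p^5` out of `p^(c+4)`.
  · rcases hc2.eq_or_lt with h | h
    · right
      have htop : secondCenter G = ⊤ :=
        Subgroup.upperCentralSeries_eq_top_iff_nilpotencyClass_le.mpr h.ge
      refine ⟨?_, htop⟩
      have h1 := card_secondCenterQuot_mul G
      rw [htop, card_top, hn, hb, hk, ← pow_add] at h1
      have := Nat.pow_right_injective hp.two_le h1
      omega
    · left
      have h1 : Group.nilpotencyClass (G ⧸ center G) = Group.nilpotencyClass G - 1 :=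
        Group.nilpotencyClass_quotient_center
      have h2 := IsPGroup.pow_nilpotencyClass_le_card_quotient_center (p := p) _ (by omega)
        (G ⧸ center G) (hP.to_quotient _) h1
      have h3 := card_eq_mul_secondCenterQuot_mul G
      rw [hn, hk, hb, ← pow_add] at h3
      have h4 := h3 ▸ Nat.mul_le_mul_left (p ^ (k + b)) h2
      rw [← pow_add, Nat.pow_le_pow_iff_right hp.one_lt] at h4
      omega

end CoclassFour

/-! ### Sufficiency of the conditions, cyclicity of the center, and class two. -/

section CentralAutomorphismsOfCoclassFour

open Subgroup
open scoped commutatorElement IsMulCommutative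

variable {p : ℕ} [Fact p.Prime]

lemma isCyclic_and_card_of_mulEquiv_cyc {Z : Type*} [Group Z] {m : ℕ} (h : Nonempty (Z ≃* Cyc m)) :
    IsCyclic Z ∧ Nat.card Z = m := by
  obtain ⟨e⟩ := h
  exact ⟨isCyclic_of_surjective e.symm e.symm.surjective,
    (Nat.card_congr e.toEquiv).trans (card_cyc m)⟩

lemma secondCenterQuot_pow_card_center_eq_one {G : Type*} [Group G] (b : SecondCenterQuot G) :
    b ^ Nat.card (center G) = 1 :=
  secondCenterQuot_pow_eq_one (fun z _ hz =>
    congrArg Subtype.val (pow_card_eq_one' (x := (⟨z, hz⟩ : center G)))) b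

lemma card_secondCenterQuot_eq_pow_rank {G : Type*} [Group G] [Finite G]
    (hZ : Nat.card (center G) = p) :
    Nat.card (SecondCenterQuot G) = p ^ Group.rank (SecondCenterQuot G) := by
  have : Finite (G →* center G) := DFunLike.finite _
  let e := secondCenterQuotEquivRange G
  rw [Nat.card_congr e.toEquiv, Group.rank_congr e]
  refine Group.card_eq_pow_rank_of_elementary fun x => ?_
  apply e.symm.injective
  rw [map_pow, map_one, ← hZ, secondCenterQuot_pow_card_center_eq_one]

lemma IsPGroup.centralAut_eq_of_rank_eq {G : Type*} [Group G] [Finite G] (hG : IsPGroup p G)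
    (hZ : Nonempty (center G ≃* Cyc p)) (hr : Group.rank G = Group.rank (SecondCenterQuot G)) :
    centralAut G = centerInnerAut G := by
  obtain ⟨hcyc, hcard⟩ := isCyclic_and_card_of_mulEquiv_cyc hZ
  apply centralAut_eq_of_index_le hcyc
  rw [card_secondCenterQuot_eq_pow_rank hcard, hcard, ← hr, ← hG.rank_abelianization]
  exact (hG.to_quotient (commutator G)).index_range_powMonoidHom_eq_pow_rank.2.le

lemma centralAut_eq_of_mulEquiv_abelianization {G : Type*} [Group G] [Finite G]
    (hcyc : IsCyclic (center G)) (h : Nonempty (SecondCenterQuot G ≃* Abelianization G)) :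
    centralAut G = centerInnerAut G := by
  obtain ⟨e⟩ := h
  apply centralAut_eq_of_index_le hcyc
  rw [Nat.card_congr e.toEquiv, index_range_powMonoidHom_of_forall_pow]
  intro x
  apply e.symm.injective
  rw [map_pow, map_one, secondCenterQuot_pow_card_center_eq_one]

lemma centralAut_eq_of_mulEquiv_cyc_prod {G : Type*} [Group G] [Finite G] {m : ℕ}
    (hZ : Nonempty (center G ≃* Cyc (p ^ 2)))
    (hB : Nonempty (SecondCenterQuot G ≃* Cyc (p ^ 2) × Cyc p))
    (hA : Nonempty (Abelianization G ≃* Cyc (p ^ m) × Cyc p)) :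
    centralAut G = centerInnerAut G := by
  obtain ⟨hcyc, hcard⟩ := isCyclic_and_card_of_mulEquiv_cyc hZ
  obtain ⟨eB⟩ := hB
  obtain ⟨eA⟩ := hA
  apply centralAut_eq_of_index_le hcyc
  rw [hcard, Nat.card_congr eB.toEquiv, Nat.card_prod, card_cyc, card_cyc, ← pow_succ,
    index_range, eA.card_ker_powMonoidHom, ← index_range]
  exact index_range_powMonoidHom_cyc_prod_le m

/-- A `p`-group of coclass `4` with `Aut_z(G) = Z(Inn(G))` is nonabelian with cyclic center. -/
lemma HasCoclass.nonabelian_and_isCyclic_center {G : Type*} [Group G] [Finite G]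
    (hG : HasCoclass p G 4) (h : centralAut G = centerInnerAut G) :
    (¬ ∀ a b : G, a * b = b * a) ∧ IsCyclic (center G) := by
  have hp := (Fact.out : p.Prime)
  have hP := hG.isPGroup
  have hcard : p < Nat.card G := by
    obtain ⟨-, n, hn, hc⟩ := hG
    rw [hn]
    exact lt_self_pow₀ hp.one_lt (by omega)
  have hna : ¬ ∀ a b : G, a * b = b * a := by
    intro hc
    have hχ : Nat.card (G →* Cyc p) = 1 := by
      rw [Nat.card_eq_one_iff_unique]
      refine ⟨⟨fun χ χ' => ?_⟩, ⟨1⟩⟩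
      ext x
      have hx : x ∈ center G := mem_center_iff.mpr fun y => hc y x
      rw [hP.map_center_eq_one_of_centralAut_eq hcard h χ ⟨x, hx⟩,
        hP.map_center_eq_one_of_centralAut_eq hcard h χ' ⟨x, hx⟩]
    rw [card_monoidHom_cyc hP, Nat.pow_eq_one] at hχ
    have h0 : Group.rank G = 0 := hχ.resolve_left hp.one_lt.ne'
    have := Group.rank_eq_zero_iff.mp h0
    rw [Nat.card_of_subsingleton (1 : G)] at hcard
    have := hp.one_lt
    omega
  refine ⟨hna, ?_⟩
  by_contra hcyc
  have hsq := hP.sq_card_monoidHom_le_of_centralAut_eq hcard h hcyc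
  have hr := two_le_rank_of_nonabelian hna
  obtain ⟨k, hk⟩ := IsPGroup.iff_card.mp (hP.to_subgroup (center G))
  obtain ⟨b, hb⟩ := IsPGroup.iff_card.mp
    ((hP.to_subgroup (secondCenter G)).to_quotient ((center G).subgroupOf (secondCenter G)))
  have hk2 : 2 ≤ k := by
    have := (hP.to_subgroup (center G)).sq_le_card_of_not_isCyclic hcyc
    rwa [hk, Nat.pow_le_pow_iff_right hp.one_lt] at this
  have hrb : Group.rank G * 2 ≤ b := by
    rwa [card_monoidHom_cyc hP, hb, ← pow_mul, Nat.pow_le_pow_iff_right hp.one_lt] at hsq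
  rcases (hG.orders hna hk hb).2 with hkb | ⟨hkb, htop⟩
  · omega
  obtain rfl : k = 2 := by omega
  obtain rfl : b = 4 := by omega
  -- The center is now elementary of order `p^2`, so `G / Z(G)`, of order `p^4`, has exponent `p`
  -- and is a quotient of `A / A^p` for `A = G / G'`. Hence `d(G) ≥ 4`, against `2 d(G) ≤ 4`.
  have hZexp (z : center G) : z ^ p = 1 := by
    obtain ⟨j, hj, hj'⟩ := (Nat.dvd_prime_pow hp).mp (hk ▸ _root_.orderOf_dvd_natCard z)
    have hj1 : j ≠ 2 := by
      rintro rfl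
      exact hcyc (isCyclic_of_orderOf_eq_card z (hj'.trans hk.symm))
    rw [← orderOf_dvd_iff_pow_eq_one, hj']
    exact (pow_dvd_pow p (by omega : j ≤ 1)).trans (pow_one p).dvd
  have hpow (g : G) : g ^ p ∈ center G := by
    have h1 := secondCenterQuot_pow_eq_one (G := G) (q := p)
      (fun z _ hz => congrArg Subtype.val (hZexp ⟨z, hz⟩))
      (QuotientGroup.mk' ((center G).subgroupOf (secondCenter G)) ⟨g, htop ▸ mem_top g⟩)
    rw [← map_pow] at h1
    exact mem_subgroupOf.mp ((QuotientGroup.eq_one_iff _).mp h1)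
  have hle : (powMonoidHom p : Abelianization G →* Abelianization G).range ≤
      (center G).map Abelianization.of := by
    rintro _ ⟨x, rfl⟩
    obtain ⟨g, rfl⟩ := QuotientGroup.mk'_surjective (commutator G) x
    exact ⟨g ^ p, hpow g, map_pow _ _ _⟩
  have hidx := Nat.le_of_dvd (Nat.pos_of_ne_zero FiniteIndex.index_ne_zero) (index_dvd_of_le hle)
  have hsurj : Function.Surjective (Abelianization.of : G →* _) :=
    QuotientGroup.mk'_surjective (commutator G)
  rw [(hP.to_quotient (commutator G)).index_range_powMonoidHom_eq_pow_rank.2, index_map,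
    Abelianization.ker_of, sup_eq_left.mpr (commutator_le_center_of_secondCenter_eq_top htop),
    MonoidHom.range_eq_top.mpr hsurj, index_top, mul_one] at hidx
  have hci : (center G).index = p ^ 4 := by
    have h1 := card_secondCenterQuot_mul G
    rw [htop, card_top, hb, ← card_mul_index (center G), mul_comm] at h1
    exact Nat.eq_of_mul_eq_mul_right Nat.card_pos h1
  rw [hci, Nat.pow_le_pow_iff_right hp.one_lt] at hidx
  change 4 ≤ Group.rank (Abelianization G) at hidx
  rw [hP.rank_abelianization] at hidx
  omega

/-- For a `p`-group of class at most two with center of order `p ^ (j + 1)`, an isomorphism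
`Z₂(G) / Z(G) ≃ A / A ^ (p ^ (j + 1))` with `A = G / G'` forces `G' = Z(G)`. -/
lemma IsPGroup.commutator_eq_center_of_mulEquiv {G : Type*} [Group G] [Finite G]
    (hP : IsPGroup p G) (htop : secondCenter G = ⊤) {j : ℕ}
    (hk : Nat.card (center G) = p ^ (j + 1))
    (e : SecondCenterQuot G ≃* Abelianization G ⧸
      (powMonoidHom (p ^ (j + 1)) : Abelianization G →* Abelianization G).range) :
    commutator G = center G := by
  have hp := (Fact.out : p.Prime)
  have hle := commutator_le_center_of_secondCenter_eq_top htop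
  by_contra hne
  -- If `G' < Z(G)`, then `p^j` kills commutators, hence `Z₂(G) / Z(G)`, hence also `A`. Then `e`
  -- gives `|G : Z(G)| = |G : G'|`, a contradiction.
  have hdvd : Nat.card (commutator G) ∣ p ^ j := by
    obtain ⟨i, hi, hi'⟩ := (Nat.dvd_prime_pow hp).mp (hk ▸ card_dvd_of_le hle)
    have : i ≠ j + 1 := by
      rintro rfl
      exact hne (eq_of_le_of_card_ge hle (by rw [hi', hk]))
    rw [hi']
    exact pow_dvd_pow p (by omega)
  have hB (b : SecondCenterQuot G) : b ^ p ^ j = 1 := by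
    refine secondCenterQuot_pow_eq_one (fun z hz _ => ?_) b
    exact orderOf_dvd_iff_pow_eq_one.mp ((Subgroup.orderOf_dvd_natCard _ hz).trans hdvd)
  have hA : ∀ x : Abelianization G, x ^ p ^ j = 1 := by
    refine (hP.to_quotient (commutator G)).pow_eq_one_of_forall_mem_range fun x => ?_
    refine (QuotientGroup.eq_one_iff _).mp ?_
    rw [QuotientGroup.mk_pow]
    apply e.symm.injective
    rw [map_pow, map_one, hB]
  have hcard : Nat.card (SecondCenterQuot G) = Nat.card (Abelianization G) := by
    rw [Nat.card_congr e.toEquiv]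
    refine index_range_powMonoidHom_of_forall_pow fun x => ?_
    rw [pow_succ, pow_mul, hA, one_pow]
  have h1 := card_secondCenterQuot_mul G
  rw [htop, card_top, hcard, ← card_abelianization_mul G] at h1
  have h2 := Nat.eq_of_mul_eq_mul_left Nat.card_pos h1
  exact hne (eq_of_le_of_card_ge hle h2.ge)

lemma forall_pow_eq_one_of_index_eq_card {A : Type*} [CommGroup A] [Finite A] {q : ℕ}
    (h : (powMonoidHom q : A →* A).range.index = Nat.card A) (x : A) : x ^ q = 1 := by
  have h1 := card_mul_index (powMonoidHom q : A →* A).range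
  rw [h] at h1
  have h2 := Nat.eq_of_mul_eq_mul_right Nat.card_pos (h1.trans (one_mul _).symm)
  have h3 := card_eq_one.mp h2
  exact mem_bot.mp (h3 ▸ (⟨x, rfl⟩ : x ^ q ∈ (powMonoidHom q : A →* A).range))

lemma nonempty_mulEquiv_abelianization {G : Type*} [Group G] {q : ℕ}
    (e : SecondCenterQuot G ≃* Abelianization G ⧸
      (powMonoidHom q : Abelianization G →* Abelianization G).range)
    (h : ∀ x : Abelianization G, x ^ q = 1) :
    Nonempty (SecondCenterQuot G ≃* Abelianization G) := by
  obtain ⟨f⟩ := nonempty_mulEquiv_quotient_pow h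
  exact ⟨e.trans f⟩

/-- In class at most two, a cyclic center equal to the derived subgroup has order at most that of
`Z₂(G) / Z(G)`. -/
lemma card_center_le_of_commutator_eq {G : Type*} [Group G] [Finite G]
    (htop : secondCenter G = ⊤) (hcyc : IsCyclic (center G)) (heq : commutator G = center G) :
    Nat.card (center G) ≤ Nat.card (SecondCenterQuot G) := by
  set q := Nat.card (SecondCenterQuot G)
  -- Since `a^q` is central, `[a, b]^q = [a^q, b] = 1`; the `q`-torsion of a cyclic group has order
  -- at most `q`.
  have hle : commutator G ≤ ((powMonoidHom q : center G →* center G).ker).map (center G).subtype := by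
    rw [_root_.commutator_def, commutator_le]
    intro a _ b _
    let a' : secondCenter G := ⟨a, htop ▸ mem_top a⟩
    have h1 : (QuotientGroup.mk' ((center G).subgroupOf (secondCenter G)) a') ^ q = 1 :=
      pow_card_eq_one'
    rw [← map_pow] at h1
    have h2 : a' ^ q ∈ (centerPairing G).ker :=
      ker_centerPairing G ▸ (QuotientGroup.eq_one_iff _).mp h1
    rw [MonoidHom.mem_ker, map_pow] at h2
    exact ⟨centerPairing G a' b, DFunLike.congr_fun h2 b, rfl⟩
  have h3 := card_le_of_le hle
  rw [heq, card_map_of_injective (center G).subtype_injective, IsCyclic.card_powMonoidHom_ker] at h3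
  exact h3.trans (Nat.gcd_le_right _ Nat.card_pos)

end CentralAutomorphismsOfCoclassFour

/-! ### The classification. -/

open Subgroup in
theorem corollary2p4 (p : ℕ) [Fact p.Prime] (G : Type*) [Group G] [Finite G]
    (hG : HasCoclass p G 4) :
    centralAut G = centerInnerAut G ↔
      (Nonempty (Subgroup.center G ≃* Cyc p) ∧
        Group.rank G = Group.rank (SecondCenterQuot G) ∧
        Group.rank G ∈ ({2, 3, 4} : Set ℕ)) ∨
      (Nonempty (Subgroup.center G ≃* Cyc (p ^ 2)) ∧
        (Nonempty (SecondCenterQuot G ≃* Abelianization G) ∨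
          (Nonempty (SecondCenterQuot G ≃* Cyc (p ^ 2) × Cyc p) ∧
            Nonempty (Abelianization G ≃* Cyc (p ^ 3) × Cyc p)) ∨
          (Nonempty (SecondCenterQuot G ≃* Cyc (p ^ 2) × Cyc p) ∧
            Nonempty (Abelianization G ≃* Cyc (p ^ 4) × Cyc p)))) ∨
      (Nonempty (Subgroup.center G ≃* Cyc (p ^ 3)) ∧
        Nonempty (SecondCenterQuot G ≃* Abelianization G)) := by
  have hp := (Fact.out : p.Prime)
  have hP := hG.isPGroup
  constructor
  swap
  · rintro (⟨hZ, hr, -⟩ | ⟨hZ, hAB | ⟨hB, hA⟩ | ⟨hB, hA⟩⟩ | ⟨hZ, hAB⟩)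
    · exact hP.centralAut_eq_of_rank_eq hZ hr
    · exact centralAut_eq_of_mulEquiv_abelianization (isCyclic_and_card_of_mulEquiv_cyc hZ).1 hAB
    · exact centralAut_eq_of_mulEquiv_cyc_prod hZ hB hA
    · exact centralAut_eq_of_mulEquiv_cyc_prod hZ hB hA
    · exact centralAut_eq_of_mulEquiv_abelianization (isCyclic_and_card_of_mulEquiv_cyc hZ).1 hAB
  intro h
  obtain ⟨hna, hcyc⟩ := hG.nonabelian_and_isCyclic_center h
  have hA : IsPGroup p (Abelianization G) := hP.to_quotient (commutator G)
  obtain ⟨k, hk⟩ := IsPGroup.iff_card.mp (hP.to_subgroup (center G))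
  obtain ⟨b, hb⟩ := IsPGroup.iff_card.mp
    ((hP.to_subgroup (secondCenter G)).to_quotient ((center G).subgroupOf (secondCenter G)))
  change Nat.card (SecondCenterQuot G) = p ^ b at hb
  have hZ {m : ℕ} (hm : Nat.card (center G) = m) : Nonempty (center G ≃* Cyc m) :=
    ⟨mulEquivOfCyclicCardEq (hm.trans (card_cyc m).symm)⟩
  obtain ⟨e⟩ := hP.nonempty_mulEquiv_of_centralAut_eq hcyc hna h
  rw [hk] at e
  have hidx : (powMonoidHom (p ^ k) : Abelianization G →* Abelianization G).range.index = p ^ b :=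
    (Nat.card_congr e.toEquiv).symm.trans hb
  obtain ⟨j, rfl⟩ : ∃ j, k = j + 1 := by
    refine Nat.exists_eq_succ_of_ne_zero ?_
    rintro rfl
    have : Nontrivial G := by
      by_contra hn
      rw [not_nontrivial_iff_subsingleton] at hn
      exact hna fun a b => Subsingleton.elim _ _
    have := hP.center_nontrivial
    have := (hP.to_subgroup (center G)).le_card_of_nontrivial
    rw [hk, pow_zero] at this
    exact absurd hp.one_lt (by omega)
  have hr := two_le_rank_of_nonabelian hna
  obtain ⟨hrank, hidxp⟩ := hA.index_range_powMonoidHom_eq_pow_rank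
  rw [hP.rank_abelianization] at hrank hidxp
  have hidx2 : p ^ 2 ≤
      (powMonoidHom p : Abelianization G →* Abelianization G).range.index :=
    hidxp ▸ Nat.pow_le_pow_right hp.pos hr
  have hb2 : 2 ≤ b := by
    have hle : (powMonoidHom (p ^ (j + 1)) : Abelianization G →* Abelianization G).range ≤
        (powMonoidHom p : Abelianization G →* Abelianization G).range := by
      rintro _ ⟨x, rfl⟩
      exact ⟨x ^ p ^ j, by rw [powMonoidHom_apply, powMonoidHom_apply, ← pow_mul, ← pow_succ]⟩
    have := hidx2.trans (index_antitone hle)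
    rwa [hidx, Nat.pow_le_pow_iff_right hp.one_lt] at this
  obtain ⟨hA5, hcases⟩ := hG.orders hna hk hb
  -- In class two `G' = Z(G)`, so `A` and `Z₂(G) / Z(G)` have equal order; the power subgroup of `A`
  -- in `e` is then trivial.
  have hexp : secondCenter G = ⊤ → commutator G = center G ∧
      Nonempty (SecondCenterQuot G ≃* Abelianization G) := by
    intro htop
    have heq := hP.commutator_eq_center_of_mulEquiv htop hk e
    refine ⟨heq, nonempty_mulEquiv_abelianization e (forall_pow_eq_one_of_index_eq_card ?_)⟩
    have h1 := card_secondCenterQuot_mul G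
    rw [htop, card_top, ← card_abelianization_mul G, heq] at h1
    rw [hidx, ← hb]
    exact (Nat.eq_of_mul_eq_mul_right Nat.card_pos h1).symm
  obtain rfl | rfl | rfl | hj : j = 0 ∨ j = 1 ∨ j = 2 ∨ 3 ≤ j := by omega
  · left
    rw [zero_add, pow_one] at hk e hidx
    have hbr : b = Group.rank G := Nat.pow_right_injective hp.two_le (hidx.symm.trans hidxp)
    refine ⟨hZ hk, hrank.symm.trans (Group.rank_congr e).symm, ?_⟩
    have hb4 : b ≤ 4 := by
      rcases hcases with hc | ⟨hc, htop⟩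
      · omega
      · exfalso
        obtain ⟨s, hs⟩ := exists_index_center_eq_mul_self htop hcyc
        obtain rfl : b = 5 := by omega
        have h1 := card_secondCenterQuot_mul G
        rw [htop, card_top, hb, ← card_mul_index (center G), mul_comm] at h1
        rw [Nat.eq_of_mul_eq_mul_right Nat.card_pos h1] at hs
        obtain ⟨i, -, rfl⟩ := (Nat.dvd_prime_pow hp).mp (hs ▸ Dvd.intro s rfl)
        rw [← pow_add] at hs
        have := Nat.pow_right_injective hp.two_le hs
        omega
    simp only [Set.mem_insert_iff, Set.mem_singleton_iff]
    omega
  · right; left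
    refine ⟨hZ hk, ?_⟩
    rcases hcases with hc | ⟨hc, htop⟩
    -- Here `b ≤ 3`. In the exceptional shape `C_{p^m} × C_p`, the bound `|A| ≤ p^5` gives `m ≤ 4`.
    · rcases hA.exponent_or_mulEquiv_of_index_le hidx2
        (hidx ▸ Nat.pow_le_pow_right hp.pos (by omega)) with hx | ⟨m, hm, ⟨f⟩⟩
      · exact Or.inl (nonempty_mulEquiv_abelianization e hx)
      · right
        obtain ⟨g⟩ := nonempty_mulEquiv_cyc_prod_of_quotient_pow (by omega) f
        have hm4 : m ≤ 4 := by
          rw [Nat.card_congr f.toEquiv, Nat.card_prod, card_cyc, card_cyc, ← pow_succ,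
            Nat.pow_le_pow_iff_right hp.one_lt] at hA5
          omega
        obtain rfl | rfl : m = 3 ∨ m = 4 := by omega
        · exact Or.inl ⟨⟨e.trans g⟩, ⟨f⟩⟩
        · exact Or.inr ⟨⟨e.trans g⟩, ⟨f⟩⟩
    · exact Or.inl (hexp htop).2
  · right; right
    refine ⟨hZ hk, ?_⟩
    rcases hcases with hc | ⟨hc, htop⟩
    -- Here `b ≤ 2`, so `|A / A^(p^3)| < p^3`, which bounds the exponent.
    · refine nonempty_mulEquiv_abelianization e (hA.pow_eq_one_of_index_lt ?_)
      rw [hidx]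
      exact Nat.pow_lt_pow_right hp.one_lt (by omega)
    · exact (hexp htop).2
  · exfalso
    -- A center of order at least `p^4` and `b ≥ 2` leave only class two with `k + b = 6`, where `k
    -- ≤ b` is impossible.
    rcases hcases with hc | ⟨hc, htop⟩
    · omega
    · have := card_center_le_of_commutator_eq htop hcyc (hexp htop).1
      rw [hk, hb, Nat.pow_le_pow_iff_right hp.one_lt] at this
      omega
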